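/- **Theorem (completeness of remote state preparation).** *Efficiency.* A family $(C_\ell)_{\ell\in\mathbb N}$ of quantum circuits is *uniform* if a Turing machine, on input $1^\ell$, outputs a description of $C_\ell$ in time polynomial in $\ell$. The gates are $X$, Hadamard, $T=\mathrm{diag}(1,e^{i\pi/4})$, CNOT, controlled phase $\mathrm{diag}(1,1,1,i)$ and Toffoli; work qubits start in $|0\rangle$, and their number is computable in unary in polynomial time from $1^\ell$. A prover or an adversary is *QPT* if each of its actions (one per message it sends, and per challenge it receives) is such a uniform circuit family followed by a computational-basis measurement of the register holding the message. A function $\mu:\mathbb N\to\mathbb R$ is *negligible* if $\ell^c\mu(\ell)\to 0$ for every $c\in\mathbb N$. "Negligibly close" refers to total variation distance at most $\mu(\ell)$ for a negligible $\mu$. *Functions.* Let $m,n=2\omega,r,t$ be functions of the security parameter $\ell\in\mathbb N$, with $m,\omega,r$ computable in unary in polynomial time from $1^\ell$. Identify $\{0,1\}^{n}$ with $\mathbb Z_4^{n/2}$ by reading pairs of bits as base-four digits. Let $\mathrm{GEN}_{\mathcal F}(1^\ell)$ and $\mathrm{GEN}_{\mathcal G}(1^\ell)$ be probability distributions on pairs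 $(k,td)\in\{0,1\}^m\times\{0,1\}^t$, and let $h_k:\{0,1\}\times\{0,1\}^n\to\{0,1\}^r$ be such that: * for every $k$ produced by $\mathrm{GEN}_{\mathcal F}$, $h_k$ is two-to-one: $h_k(0,\cdot)$ and $h_k(1,\cdot)$ are injective and have the same image; * for every $k$ produced by $\mathrm{GEN}_{\mathcal G}$, $h_k$ is injective; * the trapdoor $td$ allows inversion: maps are given that compute from $(k,td,y)$ (and, for $\mathcal F$, from $b$) the preimages of $y$ under $h_k$, and that report failure if there is none; * $h_k$ is efficiently computable: a uniform circuit family, with work qubits as above, maps $|k\rangle|b\rangle|x\rangle|0\rangle|0\rangle$ to $|k\rangle|b\rangle|x\rangle|h_k(b,x)\rangle|0\rangle$ for all such $k$, $b$, $x$. Assume that $\mathcal F$ has the adaptive $\mathbb Z_4$ hardcore bit property: there are sets $G_{k,b,x}\subseteq\mathbb Z_4^{n/2}$ such that 1. the fraction of $d\in\mathbb Z_4^{n/2}$ outside $G_{k,b,x}$ is at most a negligible function of $\ell$ (the same one for all $b$, $x$ and all $k$ produced by $\mathrm{GEN}_{\mathcal F}$); 2. let $H_k$ be the set of tuples $(b,x_b,d,W,v)$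 with $b,W,v\in\{0,1\}$, $h_k(0,x_0)=h_k(1,x_1)$, $d\in G_{k,0,x_0}\cap G_{k,1,x_1}$ and $W+2v\equiv d\cdot(x_0+x_1)\pmod 4$, let $\overline H_k$ be the set of tuples with $(b,x,d,W,1-v)\in H_k$, and for $w\in\{0,1\}$ let $H_k^w$ be the set of tuples $(b,x,d,W)$ with $(b,x,d,W+w \bmod 2,v)\in H_k$ for some $v$. Then for all QPT adversaries $A$, $A'$ the functions $|\Pr[A(k)\in H_k]-\Pr[A(k)\in\overline H_k]|$ and $|\Pr[A'(k)\in H^0_k]-\Pr[A'(k)\in H^1_k]|$, with $k$ from $\mathrm{GEN}_{\mathcal F}(1^\ell)$, are negligible. (No efficiency of key generation, of inversion or of membership in $G_{k,b,x}$, and no indistinguishability of $\mathcal F$ and $\mathcal G$, is needed.) *Protocol.* The verifier chooses $G\in\{0,1\}$ uniformly, draws $(k,td)$ from $\mathrm{GEN}_{\mathcal F}(1^\ell)$ if $G=0$ and from $\mathrm{GEN}_{\mathcal G}(1^\ell)$ if $G=1$, and sends $k$. The prover returns $y\in\{0,1\}^r$. With the trapdoor the verifier computes $x_0,x_1$ with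 $h_k(0,x_0)=h_k(1,x_1)=y$ if $G=0$, and $(\hat b,\hat x)$ with $h_k(\hat b,\hat x)=y$ if $G=1$; it aborts if this fails. It then chooses uniformly between two kinds of rounds: * 2a (preimage test): the prover returns $(b,x)$; the verifier aborts if $x\ne x_b$ (for $G=0$) or $(b,x)\neq(\hat b,\hat x)$ (for $G=1$). * 2b (measurement test): the prover returns $d\in\mathbb Z_4^{n/2}$. If $G=0$, let $\widehat W,\hat v\in\{0,1\}$ be given by $\widehat W+2\hat v\equiv d\cdot(x_1-x_0)\pmod 4$. The verifier then chooses uniformly between 3b, in which it stops without aborting, and 3a (consistency check), in which it sends a uniform $c\in\{X,\frac{X-Y}{\sqrt2},Y,\frac{X+Y}{\sqrt2},Z\}$ and the prover returns $v\in\{0,1\}$. It aborts if $G=1$, $c=Z$, $v\ne\hat b$, or if $G=0$, $c=\widehat W$ (where $\widehat W=0$ stands for $X$ and $\widehat W=1$ for $Y$), $v\neq\hat v$. The statistical (QRAC) test on the answers to $c=\frac{X\pm Y}{\sqrt2}$ (check R3a B) is not performed. The prover wins if the verifier does not abort. *Claim.* There is a QPT prover $\mathbf P$ such that for every $\ell\in\mathbb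 N$ it wins with probability $1$, and moreover: * When $G=1$, for every $(k,td)$ produced by $\mathrm{GEN}_{\mathcal G}(1^\ell)$ and all answers $y,d$ of positive probability, the post-measurement state of a designated qubit of $\mathbf P$ after returning $d$ is $|b\rangle$ (in tensor product with a pure state of the other qubits), where $h_k(b,x)=y$ for some $x$. Given $G=1$ (and a round of type 2b), the distribution of $b$ is negligibly close in $\ell$ to uniform on $\{0,1\}$. * When $G=0$, for every $(k,td)$ produced by $\mathrm{GEN}_{\mathcal F}(1^\ell)$ and all answers $y,d$ of positive probability, the post-measurement state of that qubit after returning $d$ is, in the same sense, $\frac1{\sqrt2}(|0\rangle+e^{i\theta}|1\rangle)$ with $\theta=\frac\pi2\,\bigl(d\cdot(x_1-x_0)\bmod 4\bigr)$, where $h_k(0,x_0)=h_k(1,x_1)=y$. Given $G=0$ (and a round of type 2b), the distribution of $\theta$ is negligibly close in $\ell$ to uniform on $\{0,\frac\pi2,\pi,\frac{3\pi}2\}$. -/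

import Mathlib

namespace RSP

/-! ## Quantum circuits and quantum polynomial time -/

/-- The qubits of a device. `m` key qubits, one qubit `b`, a domain register of `2 * ω` qubits (the
low and the high bit of `ω` base-four digits), `r` range qubits, a register of `2 * ω` qubits for an
equation, two further one-qubit registers `w`, `v`, and `a` work qubits. -/
inductive Wire (m ω r a : ℕ) : Type
  | key (i : Fin m)
  | b
  | xlo (j : Fin ω)
  | xhi (j : Fin ω)
  | y (i : Fin r)
  | dlo (j : Fin ω)
  | dhi (j : Fin ω)
  | w
  | v
  | anc (i : Fin a)
  deriving DecidableEq, Fintype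

/-- Elementary gates: Pauli `X`, Hadamard, `T = diag(1, e^{iπ/4})`, controlled NOT (control, target),
controlled phase `diag(1, 1, 1, i)`, and Toffoli (control, control, target). The wires of a gate are
distinct. -/
inductive Gate (W : Type) : Type
  | X (i : W)
  | H (i : W)
  | T (i : W)
  | CNOT (i j : W) (hij : i ≠ j)
  | CS (i j : W) (hij : i ≠ j)
  | CCX (i j l : W) (hij : i ≠ j) (hil : i ≠ l) (hjl : j ≠ l)

/-- A (not necessarily normalised) state vector of the qubits `W`. -/
abbrev State (W : Type) : Type := (W → Bool) → ℂ

/-- The computational basis state of a bit assignment. -/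
def basis {W : Type} [Fintype W] [DecidableEq W] (s : W → Bool) : State W :=
  fun s' => if s' = s then 1 else 0

/-- The unitary of a gate, applied to a state vector. -/
noncomputable def Gate.apply {W : Type} [DecidableEq W] : Gate W → State W → State W
  | .X i, ψ => fun s => ψ (Function.update s i (!(s i)))
  | .H i, ψ => fun s =>
      (1 / (Real.sqrt 2 : ℂ)) *
        (ψ (Function.update s i false) +
          (if s i then -1 else 1) * ψ (Function.update s i true))
  | .T i, ψ => fun s => (if s i then Complex.exp (Real.pi / 4 * Complex.I) else 1) * ψ s
  | .CNOT i j _, ψ => fun s => ψ (Function.update s j (xor (s j) (s i)))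
  | .CS i j _, ψ => fun s => (if s i && s j then Complex.I else 1) * ψ s
  | .CCX i j l _ _ _, ψ => fun s => ψ (Function.update s l (xor (s l) (s i && s j)))

/-- Circuits on the given registers: lists of gates, the first gate acting first. -/
abbrev Circuit (m ω r a : ℕ) : Type := List (Gate (Wire m ω r a))

/-- Application of a list of gates to a state vector. -/
noncomputable def run {W : Type} [DecidableEq W] (C : List (Gate W)) (ψ : State W) : State W :=
  C.foldl (fun φ g => g.apply φ) ψ

/-- The squared norm, i.e. the Born weight, of a vector. -/
noncomputable def weight {S : Type} [Fintype S] (ψ : S → ℂ) : ℝ := ∑ s, ‖ψ s‖ ^ 2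

open Classical in
/-- Projection onto the basis states that satisfy `p`: the unnormalised state after a computational
basis measurement with an outcome that is described by `p`. -/
noncomputable def project {W : Type} (p : (W → Bool) → Prop) (ψ : State W) : State W :=
  fun s => if p s then ψ s else 0

/-- Normalisation of a vector. -/
noncomputable def normalize {W : Type} [Fintype W] [DecidableEq W] (ψ : State W) : State W :=
  fun s => ψ s / (Real.sqrt (weight ψ) : ℂ)

/-- The alphabet in which circuits are written down. -/
inductive Sym : Type
  | gX | gH | gT | gCNOT | gCS | gCCX
  | rKey | rB | rXlo | rXhi | rY | rDlo | rDhi | rW | rV | rAnc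
  | tick
  deriving DecidableEq

/-- A wire is written as the name of its register followed by its position in unary. -/
def encodeWire {m ω r a : ℕ} : Wire m ω r a → List Sym
  | .key i => .rKey :: List.replicate i .tick
  | .b => [.rB]
  | .xlo j => .rXlo :: List.replicate j .tick
  | .xhi j => .rXhi :: List.replicate j .tick
  | .y i => .rY :: List.replicate i .tick
  | .dlo j => .rDlo :: List.replicate j .tick
  | .dhi j => .rDhi :: List.replicate j .tick
  | .w => [.rW]
  | .v => [.rV]
  | .anc i => .rAnc :: List.replicate i .tick

/-- A gate is written as its name followed by its wires. -/
def encodeGate {m ω r a : ℕ} : Gate (Wire m ω r a) → List Sym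
  | .X i => .gX :: encodeWire i
  | .H i => .gH :: encodeWire i
  | .T i => .gT :: encodeWire i
  | .CNOT i j _ => .gCNOT :: (encodeWire i ++ encodeWire j)
  | .CS i j _ => .gCS :: (encodeWire i ++ encodeWire j)
  | .CCX i j l _ _ _ => .gCCX :: (encodeWire i ++ encodeWire j ++ encodeWire l)

/-- The description of a circuit. -/
def encodeCircuit {m ω r a : ℕ} (C : Circuit m ω r a) : List Sym := C.flatMap encodeGate

/-- A length function that a Turing machine computes (in unary) in polynomial time from `1^ℓ`. -/
def UniformSize (f : ℕ → ℕ) : Prop :=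
  Nonempty (Turing.TM2ComputableInPolyTime Computability.unaryEncodeNat
    Computability.unaryEncodeNat f)

/-- A circuit family whose description is produced by a Turing machine in polynomial time from
`1^ℓ`; in particular the circuits have polynomial size. -/
def UniformCircuit {m ω r a : ℕ → ℕ} (C : ∀ ℓ, Circuit (m ℓ) (ω ℓ) (r ℓ) (a ℓ)) : Prop :=
  Nonempty (Turing.TM2ComputableInPolyTime Computability.unaryEncodeNat
    (id : List Sym → List Sym) (fun ℓ => encodeCircuit (C ℓ)))

/-- Negligible functions of the security parameter. -/
def Negligible (μ : ℕ → ℝ) : Prop :=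
  Asymptotics.SuperpolynomialDecay Filter.atTop (fun ℓ : ℕ => (ℓ : ℝ)) μ

/-! ## Arithmetic modulo four -/

/-- Bit strings. -/
abbrev Bits (n : ℕ) : Type := Fin n → Bool

/-- The domain `{0,1}^(2ω)`, as `ω` pairs (low bit, high bit). -/
abbrev Dom (ω : ℕ) : Type := Fin ω → Bool × Bool

/-- Two bits as an element of `ℤ/4`. -/
def digit (p : Bool × Bool) : ZMod 4 := (if p.1 then 1 else 0) + (if p.2 then 2 else 0)

/-- The identification of `{0,1}^(2ω)` with `(ℤ/4)^ω`. -/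
def vec {ω : ℕ} (x : Dom ω) : Fin ω → ZMod 4 := fun j => digit (x j)

/-- The bit `W` of the representation `t = W + 2 v` of `t ∈ ℤ/4`. -/
def bitW (t : ZMod 4) : Bool := decide (t.val % 2 = 1)

/-- The bit `v` of the representation `t = W + 2 v` of `t ∈ ℤ/4`. -/
def bitV (t : ZMod 4) : Bool := decide (2 ≤ t.val)

/-- The angle, in units of `π/2`, of the equation `d` and the preimages `x₀`, `x₁`. -/
def angle {ω : ℕ} (d : Fin ω → ZMod 4) (x₀ x₁ : Dom ω) : ZMod 4 := d ⬝ᵥ (vec x₁ - vec x₀)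

/-! ## Function families -/

/-- The bit assignment `|k⟩|b⟩|x⟩|y⟩|0⟩`, all other registers being zero. -/
def assignment {m ω r a : ℕ} (k : Bits m) (b : Bool) (x : Dom ω) (y : Bits r) :
    Wire m ω r a → Bool
  | .key i => k i
  | .b => b
  | .xlo j => (x j).1
  | .xhi j => (x j).2
  | .y i => y i
  | _ => false

/-- A pair of families `(𝓕, 𝓖)` of functions `h_k : {0,1} × {0,1}^(2ω) → {0,1}^r` with trapdoors:
`h_k` is two-to-one for the keys that `genF` produces, one-to-one for those that `genG` produces,
and it is evaluated by one uniform circuit family. -/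
structure TrapdoorFamilies where
  /-- length of keys -/
  m : ℕ → ℕ
  /-- number of base-four digits of a domain element -/
  ω : ℕ → ℕ
  /-- length of images -/
  r : ℕ → ℕ
  /-- length of trapdoors -/
  t : ℕ → ℕ
  /-- number of work qubits of the evaluation circuit -/
  a : ℕ → ℕ
  uniform_m : UniformSize m
  uniform_ω : UniformSize ω
  uniform_r : UniformSize r
  uniform_a : UniformSize a
  /-- distribution of (key, trapdoor) for the two-to-one functions -/
  genF : ∀ ℓ, PMF (Bits (m ℓ) × Bits (t ℓ))
  /-- distribution of (key, trapdoor) for the one-to-one functions -/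
  genG : ∀ ℓ, PMF (Bits (m ℓ) × Bits (t ℓ))
  /-- the function `h_k` -/
  h : ∀ ℓ, Bits (m ℓ) → Bool → Dom (ω ℓ) → Bits (r ℓ)
  /-- for each of the two bits, `h_k` is injective in the second argument -/
  injective_F : ∀ ℓ, ∀ kt ∈ (genF ℓ).support, ∀ b, Function.Injective (h ℓ kt.1 b)
  /-- the two branches of `h_k` have the same image -/
  range_F : ∀ ℓ, ∀ kt ∈ (genF ℓ).support,
    Set.range (h ℓ kt.1 false) = Set.range (h ℓ kt.1 true)
  injective_G : ∀ ℓ, ∀ kt ∈ (genG ℓ).support,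
    Function.Injective (fun p : Bool × Dom (ω ℓ) => h ℓ kt.1 p.1 p.2)
  /-- inversion of a two-to-one function on a given branch, with the trapdoor -/
  invF : ∀ ℓ, Bits (m ℓ) → Bits (t ℓ) → Bits (r ℓ) → Bool → Option (Dom (ω ℓ))
  invF_spec : ∀ ℓ, ∀ kt ∈ (genF ℓ).support, ∀ y b x,
    invF ℓ kt.1 kt.2 y b = some x ↔ h ℓ kt.1 b x = y
  /-- inversion of a one-to-one function, with the trapdoor -/
  invG : ∀ ℓ, Bits (m ℓ) → Bits (t ℓ) → Bits (r ℓ) → Option (Bool × Dom (ω ℓ))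
  invG_spec : ∀ ℓ, ∀ kt ∈ (genG ℓ).support, ∀ y b x,
    invG ℓ kt.1 kt.2 y = some (b, x) ↔ h ℓ kt.1 b x = y
  /-- the circuits that evaluate `h_k`, given `k` -/
  eval : ∀ ℓ, Circuit (m ℓ) (ω ℓ) (r ℓ) (a ℓ)
  uniform_eval : UniformCircuit eval
  /-- the evaluation circuit maps `|k⟩|b⟩|x⟩|0⟩|0⟩` to `|k⟩|b⟩|x⟩|h_k(b,x)⟩|0⟩` -/
  eval_spec : ∀ ℓ, ∀ kt : Bits (m ℓ) × Bits (t ℓ),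
    kt ∈ (genF ℓ).support ∪ (genG ℓ).support → ∀ b x,
      run (eval ℓ) (basis (assignment kt.1 b x (fun _ => false)))
        = basis (assignment kt.1 b x (h ℓ kt.1 b x))

variable (F : TrapdoorFamilies)

/-- The initial state of a device that received the key `k`. -/
def start {m ω r a : ℕ} (k : Bits m) : State (Wire m ω r a) :=
  basis (assignment k false (fun _ => (false, false)) (fun _ => false))

/-- The domain element in the domain register. -/
def readX {m ω r a : ℕ} (s : Wire m ω r a → Bool) : Dom ω := fun j => (s (.xlo j), s (.xhi j))

/-- The image in the range register. -/
def readY {m ω r a : ℕ} (s : Wire m ω r a → Bool) : Bits r := fun i => s (.y i)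

/-- The equation in the equation register. -/
def readD {m ω r a : ℕ} (s : Wire m ω r a → Bool) : Fin ω → ZMod 4 :=
  fun j => digit (s (.dlo j), s (.dhi j))

/-! ## The adaptive hardcore bit property -/

/-- An algorithm that receives a key and outputs a tuple `(b, x, d, W, v)`. -/
structure Adversary where
  /-- number of work qubits -/
  a : ℕ → ℕ
  /-- the circuits -/
  circ : ∀ ℓ, Circuit (F.m ℓ) (F.ω ℓ) (F.r ℓ) (a ℓ)

/-- Quantum polynomial time adversaries. -/
def Adversary.IsQPT {F : TrapdoorFamilies} (A : Adversary F) : Prop :=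
  UniformSize A.a ∧ UniformCircuit A.circ

/-- The probability that the output `(b, x, d, W, v)` of the adversary satisfies `p k`, for a key `k`
of a random two-to-one function. -/
noncomputable def Adversary.prob {F : TrapdoorFamilies} (A : Adversary F) (ℓ : ℕ)
    (p : Bits (F.m ℓ) → Bool → Dom (F.ω ℓ) → (Fin (F.ω ℓ) → ZMod 4) → Bool → Bool → Prop) : ℝ :=
  ∑ kt, (F.genF ℓ kt).toReal *
    weight (project (fun s => p kt.1 (s .b) (readX s) (readD s) (s .w) (s .v))
      (run (A.circ ℓ) (start kt.1)))

/-- The set of tuples `(b, x_b, d, W, v)` such that `(x₀, x₁)` is a claw of `h_k`, the equation `d` is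
good for both of its members, and `W + 2 v = d · (x₀ + x₁)` modulo four. -/
def HardSet (ℓ : ℕ)
    (good : Bits (F.m ℓ) → Bool → Dom (F.ω ℓ) → Set (Fin (F.ω ℓ) → ZMod 4))
    (k : Bits (F.m ℓ)) (b : Bool) (x : Dom (F.ω ℓ)) (d : Fin (F.ω ℓ) → ZMod 4)
    (W v : Bool) : Prop :=
  ∃ x₀ x₁ : Dom (F.ω ℓ), F.h ℓ k false x₀ = F.h ℓ k true x₁ ∧ x = (if b then x₁ else x₀) ∧
    d ∈ good k false x₀ ∧ d ∈ good k true x₁ ∧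
    W = bitW (d ⬝ᵥ (vec x₀ + vec x₁)) ∧ v = bitV (d ⬝ᵥ (vec x₀ + vec x₁))

/-- The adaptive `ℤ/4` hardcore bit property. -/
def AdaptiveHardcoreBit : Prop :=
  ∃ good : ∀ ℓ, Bits (F.m ℓ) → Bool → Dom (F.ω ℓ) → Set (Fin (F.ω ℓ) → ZMod 4),
    (∃ μ : ℕ → ℝ, Negligible μ ∧ ∀ ℓ, ∀ kt ∈ (F.genF ℓ).support, ∀ b x,
      (Set.ncard (good ℓ kt.1 b x)ᶜ : ℝ) / 4 ^ F.ω ℓ ≤ μ ℓ) ∧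
    (∀ A : Adversary F, A.IsQPT → Negligible (fun ℓ =>
      |A.prob ℓ (fun k b x d W v => HardSet F ℓ (good ℓ) k b x d W v)
        - A.prob ℓ (fun k b x d W v => HardSet F ℓ (good ℓ) k b x d W (!v))|)) ∧
    (∀ A : Adversary F, A.IsQPT → Negligible (fun ℓ =>
      |A.prob ℓ (fun k b x d W _ => ∃ v, HardSet F ℓ (good ℓ) k b x d W v)
        - A.prob ℓ (fun k b x d W _ => ∃ v, HardSet F ℓ (good ℓ) k b x d (!W) v)|))

/-! ## The protocol -/

/-- The measurement bases of the consistency check. -/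
inductive Basis : Type
  | X
  | XminusY
  | Y
  | XplusY
  | Z
  deriving DecidableEq

instance : Fintype Basis where
  elems := {.X, .XminusY, .Y, .XplusY, .Z}
  complete c := by cases c <;> simp

/-- A prover: the circuits it applies before it sends the image `y`, the preimage `(b, x)`, the
equation `d`, and the answer `v` to a basis `c`. A message is sent by measuring the register of that
name in the computational basis. -/
structure Prover where
  /-- number of work qubits -/
  a : ℕ → ℕ
  commit : ∀ ℓ, Circuit (F.m ℓ) (F.ω ℓ) (F.r ℓ) (a ℓ)
  preimage : ∀ ℓ, Circuit (F.m ℓ) (F.ω ℓ) (F.r ℓ) (a ℓ)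
  equation : ∀ ℓ, Circuit (F.m ℓ) (F.ω ℓ) (F.r ℓ) (a ℓ)
  answer : Basis → ∀ ℓ, Circuit (F.m ℓ) (F.ω ℓ) (F.r ℓ) (a ℓ)

variable {F}

/-- Quantum polynomial time provers. -/
def Prover.IsQPT (P : Prover F) : Prop :=
  UniformSize P.a ∧ UniformCircuit P.commit ∧ UniformCircuit P.preimage ∧
    UniformCircuit P.equation ∧ ∀ c, UniformCircuit (P.answer c)

/-- The unnormalised state of the prover after it received `k` and returned `y`. Its weight is the
probability of `y`. -/
noncomputable def Prover.stateY (P : Prover F) (ℓ : ℕ) (k : Bits (F.m ℓ)) (y : Bits (F.r ℓ)) :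
    State (Wire (F.m ℓ) (F.ω ℓ) (F.r ℓ) (P.a ℓ)) :=
  project (fun s => readY s = y) (run (P.commit ℓ) (start k))

/-- The unnormalised state of the prover after it returned `y` and then `(b, x)`. -/
noncomputable def Prover.stateBX (P : Prover F) (ℓ : ℕ) (k : Bits (F.m ℓ)) (y : Bits (F.r ℓ))
    (b : Bool) (x : Dom (F.ω ℓ)) : State (Wire (F.m ℓ) (F.ω ℓ) (F.r ℓ) (P.a ℓ)) :=
  project (fun s => s .b = b ∧ readX s = x) (run (P.preimage ℓ) (P.stateY ℓ k y))

/-- The unnormalised state of the prover after it returned `y` and then `d`. -/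
noncomputable def Prover.stateD (P : Prover F) (ℓ : ℕ) (k : Bits (F.m ℓ)) (y : Bits (F.r ℓ))
    (d : Fin (F.ω ℓ) → ZMod 4) : State (Wire (F.m ℓ) (F.ω ℓ) (F.r ℓ) (P.a ℓ)) :=
  project (fun s => readD s = d) (run (P.equation ℓ) (P.stateY ℓ k y))

/-- The unnormalised state of the prover after it returned `y`, then `d`, and then `v` to `c`. -/
noncomputable def Prover.stateV (P : Prover F) (ℓ : ℕ) (k : Bits (F.m ℓ)) (y : Bits (F.r ℓ))
    (d : Fin (F.ω ℓ) → ZMod 4) (c : Basis) (v : Bool) :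
    State (Wire (F.m ℓ) (F.ω ℓ) (F.r ℓ) (P.a ℓ)) :=
  project (fun s => s .v = v) (run (P.answer c ℓ) (P.stateD ℓ k y d))

/-- What the verifier computes from `y`: two preimages `(0, x₀)`, `(1, x₁)`, or one `(b, x)`. -/
inductive Preimages (ω : ℕ) : Type
  | two (x₀ x₁ : Dom ω)
  | one (b : Bool) (x : Dom ω)

variable (F)

/-- The distribution of (key, trapdoor) for the bit `G` (`false` for `0`, `true` for `1`). -/
noncomputable def gen (ℓ : ℕ) (G : Bool) : PMF (Bits (F.m ℓ) × Bits (F.t ℓ)) :=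
  if G then F.genG ℓ else F.genF ℓ

/-- The verifier inverts `y` with the trapdoor; `none` if an inversion fails. -/
def invert (ℓ : ℕ) (G : Bool) (kt : Bits (F.m ℓ) × Bits (F.t ℓ)) (y : Bits (F.r ℓ)) :
    Option (Preimages (F.ω ℓ)) :=
  if G then (F.invG ℓ kt.1 kt.2 y).map (fun p => .one p.1 p.2)
  else (F.invF ℓ kt.1 kt.2 y false).bind fun x₀ =>
    (F.invF ℓ kt.1 kt.2 y true).map fun x₁ => .two x₀ x₁

/-- The preimage test. -/
def PreimageTest {ω : ℕ} : Preimages ω → Bool → Dom ω → Prop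
  | .two x₀ x₁, b, x => x = (if b then x₁ else x₀)
  | .one b' x', b, x => b = b' ∧ x = x'

/-- The consistency check, without its statistical part for the bases `(X ± Y)/√2`. The bit `W` of
the angle stands for the basis `X` (if `0`) or `Y` (if `1`). -/
def ConsistencyCheck {ω : ℕ} : Preimages ω → (Fin ω → ZMod 4) → Basis → Bool → Prop
  | .two x₀ x₁, d, c, v =>
      ((c = .X ∧ bitW (angle d x₀ x₁) = false) ∨ (c = .Y ∧ bitW (angle d x₀ x₁) = true)) →
        v = bitV (angle d x₀ x₁)
  | .one b _, _, c, v => c = .Z → v = b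

open Classical in
/-- The indicator of a proposition. -/
noncomputable def ind (p : Prop) : ℝ := if p then 1 else 0

variable {F}

/-- The probability that the verifier does not abort, given `G`, the key and the trapdoor. The round
types are uniform in `{2a, 2b}` and `{3a, 3b}`, the basis is uniform among the five. A verifier that
cannot invert `y` aborts. -/
noncomputable def Prover.winProbGiven (P : Prover F) (ℓ : ℕ) (G : Bool)
    (kt : Bits (F.m ℓ) × Bits (F.t ℓ)) : ℝ :=
  ∑ y, ((1 / 2) * (∑ b, ∑ x,
        ind (∃ p, invert F ℓ G kt y = some p ∧ PreimageTest p b x)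
          * weight (P.stateBX ℓ kt.1 y b x)) +
    (1 / 2) * (∑ d,
      ((1 / 2) * (∑ c, (1 / 5) * ∑ v,
          ind (∃ p, invert F ℓ G kt y = some p ∧ ConsistencyCheck p d c v)
            * weight (P.stateV ℓ kt.1 y d c v)) +
        (1 / 2) * (ind (∃ p, invert F ℓ G kt y = some p) * weight (P.stateD ℓ kt.1 y d)))))

/-- The probability that the prover wins, i.e. that the verifier does not abort. -/
noncomputable def Prover.winProb (P : Prover F) (ℓ : ℕ) : ℝ :=
  ∑ G, (1 / 2) * ∑ kt, (gen F ℓ G kt).toReal * P.winProbGiven ℓ G kt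

/-- The distribution of the bit `b` (known to the verifier) after `d` was returned, given `G = 1`. -/
noncomputable def Prover.distB (P : Prover F) (ℓ : ℕ) (β : Bool) : ℝ :=
  ∑ kt, (F.genG ℓ kt).toReal * ∑ y, ∑ d,
    ind (∃ x, invert F ℓ true kt y = some (.one β x)) * weight (P.stateD ℓ kt.1 y d)

/-- The distribution of the angle, in units of `π/2`, after `d` was returned, given `G = 0`. -/
noncomputable def Prover.distAngle (P : Prover F) (ℓ : ℕ) (τ : ZMod 4) : ℝ :=
  ∑ kt, (F.genF ℓ kt).toReal * ∑ y, ∑ d,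
    ind (∃ x₀ x₁, invert F ℓ false kt y = some (.two x₀ x₁) ∧ angle d x₀ x₁ = τ)
      * weight (P.stateD ℓ kt.1 y d)

/-- The total variation distance of `p` to the uniform distribution. -/
noncomputable def distToUniform {S : Type} [Fintype S] (p : S → ℝ) : ℝ :=
  (1 / 2) * ∑ s, |p s - 1 / (Fintype.card S : ℝ)|

/-- The qubit `|b⟩`. -/
def ket (b : Bool) : Bool → ℂ := fun c => if c = b then 1 else 0

/-- The qubit `|+_θ⟩ = (|0⟩ + e^{iθ}|1⟩)/√2`. -/
noncomputable def ketPlus (θ : ℝ) : Bool → ℂ :=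
  fun c => (1 / (Real.sqrt 2 : ℂ)) * (if c then Complex.exp (θ * Complex.I) else 1)

/-- The qubit `b` is in the pure state `q`: the state of the device is the tensor product of `q` on
that qubit and a unit vector on the other ones. -/
def HoldsQubit {m ω r a : ℕ} (ψ : State (Wire m ω r a)) (q : Bool → ℂ) : Prop :=
  ∃ χ : State {i : Wire m ω r a // i ≠ .b}, weight χ = 1 ∧
    ∀ s, ψ s = q (s .b) * χ (fun i => s i)

end RSP

/-!
The honest prover prepares `∑_{b,x} |b⟩|x⟩`, computes `h k b x` into the register of `y` and measures
it. For a preimage test it measures `(b, x)`. For an equation it applies the Fourier transform over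
`ℤ/4` to each digit of `x` separately and measures the result `d`; what remains is the qubit `b`.
A branch `(b, x)` with `h k b x = y` then carries the amplitude `i ^ (d ⬝ᵥ x)` up to a common factor
(`stateD_honest`), so the qubit is `|b⟩` if `y` has one preimage, and, up to a global phase,
`(|0⟩ + i ^ (d ⬝ᵥ (x₁ - x₀)) |1⟩) / √2` if it has two. A challenge in the plane of `X` and `Y` is
answered by a rotation with powers of `T` and a Hadamard gate, so the answers that the verifier
checks are determined by the state, and the prover always wins (`winProb_honest`).

*Distributions.* Every `d` occurs with the same probability, in both branches. For injective keys
the bit is therefore uniform (`distToUniform_distB`). For two-to-one keys the angle is `d ⬝ᵥ Δ` with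
`d` uniform and `Δ = x₁ - x₀`, which is uniform on `ℤ/4` unless all entries of `Δ` are even. So the
distance to the uniform distribution is at most the fraction of claws with an even difference, and
this fraction has to be shown negligible. Here the hardcore bit property enters, through an adversary
that ignores the key: it returns uniform `b`, `x`, `d` and the guess `W = 0`. The low bit of
`d ⬝ᵥ Δ` is always `0` for even `Δ` and unbiased for all other `Δ`, so the advantage of this guess
is the fraction of even claws, up to the fraction of equations outside the sets `G`
(`guess_bias_ge`, `negligible_evenFraction`).

*Uniformity.* All circuits are made of loops of fixed gates over the digits and, in one of them, the
given circuit for `h`. A polynomial-time machine for such a circuit is built by composition: the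
machines that are given for the size functions and for the rest of the circuit are embedded as
subroutines in a stack machine (`prependTM`) that prints the loop in front of the rest
(`UniformText.prepend`, `UniformCircuit.loop`).
-/

namespace RSP

open Turing

/-! ### Stack machines: embedding and running time -/

/-- `b` is reached from `a` by exactly `n` steps of `f`. -/
inductive ReachesIn {S : Type*} (f : S → Option S) : ℕ → S → S → Prop
  | refl (a : S) : ReachesIn f 0 a a
  | head {n : ℕ} {a b c : S} : f a = some b → ReachesIn f n b c → ReachesIn f (n + 1) a c

namespace ReachesIn

variable {S : Type*} {f : S → Option S}

theorem trans {n n' : ℕ} {a b c : S} (h : ReachesIn f n a b) (h' : ReachesIn f n' b c) :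
    ReachesIn f (n + n') a c := by
  induction h with
  | refl => simpa using h'
  | head hs _ ih => rw [Nat.add_right_comm]; exact head hs (ih h')

theorem single {a b : S} (h : f a = some b) : ReachesIn f 1 a b := head h (refl b)

theorem iterate_none (f : S → Option S) (n : ℕ) : (flip bind f)^[n] none = none := by
  induction n with
  | zero => rfl
  | succ n ih => rw [Function.iterate_succ_apply]; exact ih

theorem iff_iterate {n : ℕ} {a b : S} :
    ReachesIn f n a b ↔ (flip bind f)^[n] (some a) = some b := by
  constructor
  · intro h
    induction h with
    | refl => rfl
    | head hs _ ih =>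
      rw [Function.iterate_succ_apply]
      simpa [flip, hs] using ih
  · intro h
    induction n generalizing a with
    | zero => cases h; exact refl _
    | succ n ih =>
      rw [Function.iterate_succ_apply] at h
      cases hs : f a with
      | none =>
        have : flip bind f (some a) = none := by simpa [flip] using hs
        rw [this, iterate_none] at h
        cases h
      | some a' =>
        have : flip bind f (some a) = some a' := by simpa [flip] using hs
        rw [this] at h
        exact head hs (ih h)

end ReachesIn

section Embedding

open TM2 TM2.Stmt

variable {K K' : Type} [DecidableEq K] [DecidableEq K'] {Γ' : K' → Type}
  {Λ Λ' σ σ' : Type}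

/-- The statement of a machine as a part of a bigger one: `ι` is the inclusion of its stacks, `lab`
that of its labels, `get` and `set` access its internal state, and instead of halting the bigger
machine continues at `exit`. -/
def embedStmt (ι : K → K') (lab : Λ → Λ') (exit : Λ') (get : σ' → σ) (set : σ → σ' → σ') :
    Stmt (fun k => Γ' (ι k)) Λ σ → Stmt Γ' Λ' σ'
  | push k f q => push (ι k) (fun v => f (get v)) (embedStmt ι lab exit get set q)
  | peek k f q => peek (ι k) (fun v x => set (f (get v) x) v) (embedStmt ι lab exit get set q)
  | pop k f q => pop (ι k) (fun v x => set (f (get v) x) v) (embedStmt ι lab exit get set q)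
  | load f q => load (fun v => set (f (get v)) v) (embedStmt ι lab exit get set q)
  | branch f q₁ q₂ => branch (fun v => f (get v)) (embedStmt ι lab exit get set q₁)
      (embedStmt ι lab exit get set q₂)
  | goto l => goto (fun v => lab (l (get v)))
  | halt => goto (fun _ => exit)

/-- The configuration `c'` of the bigger machine shows the configuration `c` of an embedded one, and
agrees outside of it with the internal state `w` and the stacks `T`. -/
structure Shows (ι : K → K') (lab : Λ → Λ') (exit : Λ') (set : σ → σ' → σ') (w : σ')
    (T : ∀ k, List (Γ' k)) (c : Cfg (fun k => Γ' (ι k)) Λ σ) (c' : Cfg Γ' Λ' σ') : Prop where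
  l : c'.l = some (c.l.elim exit lab)
  var : c'.var = set c.var w
  inside : ∀ k, c'.stk (ι k) = c.stk k
  outside : ∀ k, k ∉ Set.range ι → c'.stk k = T k

variable {ι : K → K'} {lab : Λ → Λ'} {exit : Λ'} {get : σ' → σ} {set : σ → σ' → σ'}

theorem shows_stepAux (hι : Function.Injective ι) (hgs : ∀ a w, get (set a w) = a)
    (hss : ∀ a b w, set a (set b w) = set a w) (w : σ') (T : ∀ k, List (Γ' k))
    (q : Stmt (fun k => Γ' (ι k)) Λ σ) (v : σ) (S : ∀ k, List (Γ' (ι k))) (S' : ∀ k, List (Γ' k))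
    (hin : ∀ k, S' (ι k) = S k) (hout : ∀ k, k ∉ Set.range ι → S' k = T k) :
    Shows ι lab exit set w T (stepAux q v S)
      (stepAux (embedStmt ι lab exit get set q) (set v w) S') := by
  -- the two conditions on the stacks survive the replacement of one embedded stack
  have upd : ∀ (S : ∀ k, List (Γ' (ι k))) (S' : ∀ k, List (Γ' k)), (∀ k, S' (ι k) = S k) →
      (∀ k, k ∉ Set.range ι → S' k = T k) → ∀ (k : K) (a : List (Γ' (ι k))),
      (∀ j, Function.update S' (ι k) a (ι j) = Function.update S k a j) ∧
      (∀ j, j ∉ Set.range ι → Function.update S' (ι k) a j = T j) := by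
    intro S S' hin hout k a
    refine ⟨fun j => ?_, fun j hj => ?_⟩
    · by_cases h : j = k
      · subst h; simp
      · rw [Function.update_of_ne h, Function.update_of_ne (fun e => h (hι e)), hin]
    · rw [Function.update_of_ne (fun e => hj ⟨k, e.symm⟩), hout j hj]
  induction q generalizing v S S' with
  | push k f q ih =>
    simp only [embedStmt, stepAux, hgs, hin]
    exact ih _ _ _ (upd S S' hin hout k _).1 (upd S S' hin hout k _).2
  | peek k f q ih =>
    simp only [embedStmt, stepAux, hgs, hin, hss]
    exact ih _ _ _ hin hout
  | pop k f q ih =>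
    simp only [embedStmt, stepAux, hgs, hin, hss]
    exact ih _ _ _ (upd S S' hin hout k _).1 (upd S S' hin hout k _).2
  | load f q ih =>
    simp only [embedStmt, stepAux, hgs, hss]
    exact ih _ _ _ hin hout
  | branch f q₁ q₂ ih₁ ih₂ =>
    simp only [embedStmt, stepAux, hgs]
    cases f v
    · exact ih₂ _ _ _ hin hout
    · exact ih₁ _ _ _ hin hout
  | goto l =>
    simp only [embedStmt, stepAux, hgs]
    exact ⟨rfl, rfl, hin, hout⟩
  | halt =>
    simp only [embedStmt, stepAux]
    exact ⟨rfl, rfl, hin, hout⟩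

/-- A run of the embedded machine is shown by a run of the bigger one, step by step. -/
theorem Shows.reachesIn (hι : Function.Injective ι) (hgs : ∀ a w, get (set a w) = a)
    (hss : ∀ a b w, set a (set b w) = set a w) {w : σ'} {T : ∀ k, List (Γ' k)}
    {M : Λ → Stmt (fun k => Γ' (ι k)) Λ σ} {M' : Λ' → Stmt Γ' Λ' σ'}
    (hM : ∀ l, M' (lab l) = embedStmt ι lab exit get set (M l))
    {n : ℕ} {c d : Cfg (fun k => Γ' (ι k)) Λ σ} {c' : Cfg Γ' Λ' σ'}
    (hc : Shows ι lab exit set w T c c') (h : ReachesIn (step M) n c d) :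
    ∃ d', ReachesIn (step M') n c' d' ∧ Shows ι lab exit set w T d d' := by
  induction h generalizing c' with
  | refl c => exact ⟨c', .refl _, hc⟩
  | @head n a b d hs _ ih =>
    obtain ⟨l, v, S⟩ := a
    obtain ⟨l', v', S'⟩ := c'
    obtain ⟨h1, h2, h3, h4⟩ := hc
    simp only at h1 h2 h3 h4
    cases l with
    | none => simp at hs
    | some l =>
      simp only [step, Option.some.injEq] at hs
      simp only [Option.elim_some] at h1
      subst h1 h2 hs
      obtain ⟨d', hd, hd'⟩ := ih (c' := stepAux (M' (lab l)) (set v w) S')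
        (by rw [hM]; exact shows_stepAux hι hgs hss w T (M l) v S S' h3 h4)
      exact ⟨d', .head rfl hd, hd'⟩

end Embedding

section Growth

open TM2 TM2.Stmt

variable {K : Type} [DecidableEq K] {Γ : K → Type} {Λ σ : Type}

/-- The number of push instructions in a statement. -/
def pushCount : Stmt Γ Λ σ → ℕ
  | push _ _ q => pushCount q + 1
  | peek _ _ q => pushCount q
  | pop _ _ q => pushCount q
  | load _ q => pushCount q
  | branch _ q₁ q₂ => pushCount q₁ + pushCount q₂
  | goto _ => 0
  | halt => 0

theorem length_stepAux_le (q : Stmt Γ Λ σ) (v : σ) (S : ∀ k, List (Γ k)) (k : K) :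
    ((stepAux q v S).stk k).length ≤ (S k).length + pushCount q := by
  induction q generalizing v S with
  | push k' f q ih =>
    refine (ih _ _).trans ?_
    by_cases h : k = k'
    · subst h; simp [pushCount]; omega
    · simp [pushCount, Function.update_of_ne h]
  | peek k' f q ih => exact ih _ _
  | pop k' f q ih =>
    refine (ih _ _).trans ?_
    by_cases h : k = k'
    · subst h; simp [pushCount]
    · simp [pushCount, Function.update_of_ne h]
  | load f q ih => exact ih _ _
  | branch f q₁ q₂ ih₁ ih₂ =>
    simp only [stepAux, pushCount]
    cases f v
    · exact (ih₂ _ _).trans (by omega)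
    · exact (ih₁ _ _).trans (by omega)
  | goto l => simp [pushCount]
  | halt => simp [pushCount]

/-- A stack grows by a bounded amount in each step. -/
theorem length_le_of_reachesIn [Fintype Λ] {M : Λ → Stmt Γ Λ σ} {n : ℕ} {c d : Cfg Γ Λ σ}
    (h : ReachesIn (step M) n c d) (k : K) :
    (d.stk k).length ≤ (c.stk k).length + n * ∑ l, pushCount (M l) := by
  induction h with
  | refl => simp
  | @head n a b d hs _ ih =>
    obtain ⟨l, v, S⟩ := a
    cases l with
    | none => simp at hs
    | some l =>
      simp only [step, Option.some.injEq] at hs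
      subst hs
      have h1 := length_stepAux_le (M l) v S k
      have h2 : pushCount (M l) ≤ ∑ l, pushCount (M l) :=
        Finset.single_le_sum (f := fun l => pushCount (M l)) (fun _ _ => Nat.zero_le _)
          (Finset.mem_univ l)
      rw [Nat.succ_mul]
      change _ ≤ (S k).length + _
      omega

/-- A statement that pushes a list, so that it ends up on top of the stack with its head first. -/
def pushList (k : K) : List (Γ k) → Stmt Γ Λ σ → Stmt Γ Λ σ
  | [], q => q
  | a :: l, q => pushList k l (push k (fun _ => a) q)

theorem stepAux_pushList (k : K) (l : List (Γ k)) (q : Stmt Γ Λ σ) (v : σ)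
    (S : ∀ k, List (Γ k)) :
    stepAux (pushList k l q) v S = stepAux q v (Function.update S k (l ++ S k)) := by
  induction l generalizing q with
  | nil => simp [pushList]
  | cons a l ih => simp [pushList, ih]

end Growth

theorem initList_stk (tm : FinTM2) (s : List (tm.Γ tm.k₀)) :
    (initList tm s).stk = Function.update (fun _ => []) tm.k₀ s := by
  funext k
  by_cases h : k = tm.k₀
  · subst h; simp [initList]
  · simp [initList, h]

theorem haltList_stk (tm : FinTM2) (s : List (tm.Γ tm.k₁)) :
    (haltList tm s).stk = Function.update (fun _ => []) tm.k₁ s := by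
  funext k
  by_cases h : k = tm.k₁
  · subst h; simp [haltList]
  · simp [haltList, h]

theorem unaryEncodeNat_eq_replicate (n : ℕ) :
    Computability.unaryEncodeNat n = List.replicate n true := by
  induction n with
  | zero => rfl
  | succ n ih => simp [Computability.unaryEncodeNat, ih, List.replicate_succ]

/-! ### A machine that writes a loop in front of a list -/

/-- The text `p ‖^j` for each `p` in `ps`, for a fixed position `j`. -/
def blockText (ps : List (List Sym)) (j : ℕ) : List Sym :=
  ps.flatMap fun p => p ++ List.replicate j .tick

/-- The concatenation of the texts `blockText ps j` for `j < n`. -/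
def loopText (ps : List (List Sym)) (n : ℕ) : List Sym :=
  (List.range n).flatMap (blockText ps)

/-- The control labels of the machine `prependTM`. -/
inductive Ctl (n : ℕ) : Type
  | fork
  | header
  | loop
  | up (i : Fin (n + 1))
  | down (i : Fin (n + 1))
  deriving Fintype

section Machine

open TM2 TM2.Stmt

variable (tm₁ tm₂ : FinTM2)

/-- The stacks of `tm₁`, those of `tm₂`, and one of Booleans. -/
abbrev prependΓ : tm₁.K ⊕ (tm₂.K ⊕ Unit) → Type
  | .inl k => tm₁.Γ k
  | .inr (.inl k) => tm₂.Γ k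
  | .inr (.inr _) => Bool

/-- The labels of `tm₁`, those of `tm₂`, and those of the control. -/
abbrev PrependΛ (n : ℕ) : Type := tm₁.Λ ⊕ (tm₂.Λ ⊕ Ctl n)

/-- The internal states of `tm₁` and `tm₂`, and whether the last control instruction popped a
symbol. -/
abbrev Prependσ : Type := tm₁.σ × tm₂.σ × Bool

/-- Stack contents of the machine `prependTM`. -/
def join (S₁ : ∀ k, List (tm₁.Γ k)) (S₂ : ∀ k, List (tm₂.Γ k)) (D : List Bool) :
    ∀ k, List (prependΓ tm₁ tm₂ k)
  | .inl k => S₁ k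
  | .inr (.inl k) => S₂ k
  | .inr (.inr _) => D

variable {tm₁ tm₂}

theorem update_join_left (S₁ : ∀ k, List (tm₁.Γ k)) (S₂ : ∀ k, List (tm₂.Γ k)) (D : List Bool)
    (k : tm₁.K) (a : List (tm₁.Γ k)) :
    Function.update (join tm₁ tm₂ S₁ S₂ D) (.inl k) a
      = join tm₁ tm₂ (Function.update S₁ k a) S₂ D := by
  funext j
  rcases j with j | j | j
  · by_cases h : j = k
    · subst h; simp [join]
    · simp [join, h]
  · simp [join]
  · simp [join]

theorem update_join_middle (S₁ : ∀ k, List (tm₁.Γ k)) (S₂ : ∀ k, List (tm₂.Γ k)) (D : List Bool)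
    (k : tm₂.K) (a : List (tm₂.Γ k)) :
    Function.update (join tm₁ tm₂ S₁ S₂ D) (.inr (.inl k)) a
      = join tm₁ tm₂ S₁ (Function.update S₂ k a) D := by
  funext j
  rcases j with j | j | j
  · simp [join]
  · by_cases h : j = k
    · subst h; simp [join]
    · simp [join, h]
  · simp [join]

theorem update_join_right (S₁ : ∀ k, List (tm₁.Γ k)) (S₂ : ∀ k, List (tm₂.Γ k)) (D : List Bool)
    (a : List Bool) :
    Function.update (join tm₁ tm₂ S₁ S₂ D) (.inr (.inr ())) a = join tm₁ tm₂ S₁ S₂ a := by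
  funext j
  rcases j with j | j | j
  · simp [join]
  · simp [join]
  · simp [join]

variable (tm₁ tm₂)

/-- A control instruction that pops a symbol and records whether there was one. -/
def popFlag {n : ℕ} (k : tm₁.K ⊕ (tm₂.K ⊕ Unit))
    (q : Stmt (prependΓ tm₁ tm₂) (PrependΛ tm₁ tm₂ n) (Prependσ tm₁ tm₂)) :
    Stmt (prependΓ tm₁ tm₂) (PrependΛ tm₁ tm₂ n) (Prependσ tm₁ tm₂) :=
  pop k (fun v x => (v.1, v.2.1, x.isSome)) q

/-- Jump to a control label. -/
def gotoCtl {n : ℕ} (c : Ctl n) :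
    Stmt (prependΓ tm₁ tm₂) (PrependΛ tm₁ tm₂ n) (Prependσ tm₁ tm₂) :=
  goto fun _ => .inr (.inr c)

/-- The control program. `fork` copies the unary input to the inputs of both machines, which then
run one after the other; the output of `tm₂` is a unary counter, that of `tm₁` the list to which
text is prepended. `header` writes `c`. Each pass of `loop` decrements the counter to some `j` and
writes `blockText ps j` from right to left: `up i` writes `j` ticks while it moves the counter to the
spare stack, and `down i` moves it back and writes the element `i - 1` of `ps`. -/
def prependCtl (t₁ : tm₁.Γ tm₁.k₀) (t₂ : tm₂.Γ tm₂.k₀) (one : tm₂.Γ tm₂.k₁)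
    (o : Sym → tm₁.Γ tm₁.k₁) (c : List Sym) (ps : List (List Sym)) :
    Ctl ps.length → Stmt (prependΓ tm₁ tm₂) (PrependΛ tm₁ tm₂ ps.length) (Prependσ tm₁ tm₂)
  | .fork => popFlag tm₁ tm₂ (.inr (.inr ())) <| branch (fun v => v.2.2)
      (push (.inl tm₁.k₀) (fun _ => t₁) <| push (.inr (.inl tm₂.k₀)) (fun _ => t₂) <|
        gotoCtl tm₁ tm₂ .fork)
      (goto fun _ => .inl tm₁.main)
  | .header => pushList (.inl tm₁.k₁) (c.map o) <| gotoCtl tm₁ tm₂ .loop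
  | .loop => popFlag tm₁ tm₂ (.inr (.inl tm₂.k₁)) <| branch (fun v => v.2.2)
      (gotoCtl tm₁ tm₂ (.up (Fin.last _))) halt
  | .up ⟨0, _⟩ => gotoCtl tm₁ tm₂ .loop
  | .up ⟨i + 1, hi⟩ => popFlag tm₁ tm₂ (.inr (.inl tm₂.k₁)) <| branch (fun v => v.2.2)
      (push (.inr (.inr ())) (fun _ => true) <| push (.inl tm₁.k₁) (fun _ => o .tick) <|
        gotoCtl tm₁ tm₂ (.up ⟨i + 1, hi⟩))
      (gotoCtl tm₁ tm₂ (.down ⟨i + 1, hi⟩))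
  | .down ⟨0, _⟩ => gotoCtl tm₁ tm₂ .loop
  | .down ⟨i + 1, hi⟩ => popFlag tm₁ tm₂ (.inr (.inr ())) <| branch (fun v => v.2.2)
      (push (.inr (.inl tm₂.k₁)) (fun _ => one) <| gotoCtl tm₁ tm₂ (.down ⟨i + 1, hi⟩))
      (pushList (.inl tm₁.k₁) ((ps[i]'(Nat.lt_of_succ_lt_succ hi)).map o) <|
        gotoCtl tm₁ tm₂ (.up ⟨i, Nat.lt_of_succ_lt hi⟩))

/-- The program: the programs of the two machines and the control program. -/
def prependProg (t₁ : tm₁.Γ tm₁.k₀) (t₂ : tm₂.Γ tm₂.k₀) (one : tm₂.Γ tm₂.k₁)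
    (o : Sym → tm₁.Γ tm₁.k₁) (c : List Sym) (ps : List (List Sym)) :
    PrependΛ tm₁ tm₂ ps.length →
      Stmt (prependΓ tm₁ tm₂) (PrependΛ tm₁ tm₂ ps.length) (Prependσ tm₁ tm₂)
  | .inl l => embedStmt (Γ' := prependΓ tm₁ tm₂) Sum.inl Sum.inl (.inr (.inl tm₂.main))
      (fun v => v.1) (fun a v => (a, v.2)) (tm₁.m l)
  | .inr (.inl l) => embedStmt (Γ' := prependΓ tm₁ tm₂) (fun k => Sum.inr (Sum.inl k))
      (fun l => Sum.inr (Sum.inl l)) (.inr (.inr .header))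
      (fun v => v.2.1) (fun a v => (v.1, a, v.2.2)) (tm₂.m l)
  | .inr (.inr l) => prependCtl tm₁ tm₂ t₁ t₂ one o c ps l

/-- The machine that writes the text of a loop, with a number of passes computed by `tm₂`, and the
text `c` in front of the output of `tm₁`. -/
def prependTM (t₁ : tm₁.Γ tm₁.k₀) (t₂ : tm₂.Γ tm₂.k₀) (one : tm₂.Γ tm₂.k₁)
    (o : Sym → tm₁.Γ tm₁.k₁) (c : List Sym) (ps : List (List Sym)) : FinTM2 :=
  letI := tm₁.kFin
  letI := tm₂.kFin
  letI := tm₁.ΛFin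
  letI := tm₂.ΛFin
  letI := tm₁.σFin
  letI := tm₂.σFin
  { K := tm₁.K ⊕ (tm₂.K ⊕ Unit)
    k₀ := .inr (.inr ())
    k₁ := .inl tm₁.k₁
    Γ := prependΓ tm₁ tm₂
    Λ := PrependΛ tm₁ tm₂ ps.length
    main := .inr (.inr .fork)
    σ := Prependσ tm₁ tm₂
    initialState := (tm₁.initialState, tm₂.initialState, false)
    Γk₀Fin := inferInstanceAs (Fintype Bool)
    m := prependProg tm₁ tm₂ t₁ t₂ one o c ps }

variable {tm₁ tm₂}
variable (t₁ : tm₁.Γ tm₁.k₀) (t₂ : tm₂.Γ tm₂.k₀) (one : tm₂.Γ tm₂.k₁)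
    (o : Sym → tm₁.Γ tm₁.k₁) (c : List Sym) (ps : List (List Sym))

/-- The configurations at a control label, with both machines in their initial states. -/
def ctlCfg {n : ℕ} (l : Ctl n) (flag : Bool) (S₁ : ∀ k, List (tm₁.Γ k))
    (S₂ : ∀ k, List (tm₂.Γ k)) (D : List Bool) :
    Cfg (prependΓ tm₁ tm₂) (PrependΛ tm₁ tm₂ n) (Prependσ tm₁ tm₂) :=
  ⟨some (.inr (.inr l)), (tm₁.initialState, tm₂.initialState, flag), join tm₁ tm₂ S₁ S₂ D⟩

/-- Stacks that are empty except for one. -/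
abbrev only {K : Type} [DecidableEq K] {Γ : K → Type} (k : K) (l : List (Γ k)) :
    ∀ k, List (Γ k) := Function.update (fun _ => []) k l

theorem reaches_fork (n : ℕ) (flag : Bool) (i j : ℕ) :
    ReachesIn (step (prependProg tm₁ tm₂ t₁ t₂ one o c ps)) (n + 1)
      (ctlCfg .fork flag (only tm₁.k₀ (List.replicate i t₁)) (only tm₂.k₀ (List.replicate j t₂))
        (List.replicate n true))
      ⟨some (.inl tm₁.main), (tm₁.initialState, tm₂.initialState, false),
        join tm₁ tm₂ (only tm₁.k₀ (List.replicate (n + i) t₁))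
          (only tm₂.k₀ (List.replicate (n + j) t₂)) []⟩ := by
  induction n generalizing flag i j with
  | zero =>
    refine .single ?_
    simp only [ctlCfg, step, prependProg, prependCtl, popFlag, stepAux, join, List.replicate,
      List.head?_nil, List.tail_nil, update_join_right, Option.isSome_none, cond_false, Nat.zero_add]
  | succ n ih =>
    refine .head ?_ (by
      have := ih true (i + 1) (j + 1)
      rwa [show n + (i + 1) = n + 1 + i by omega, show n + (j + 1) = n + 1 + j by omega] at this)
    simp only [ctlCfg, step, prependProg, prependCtl, popFlag, stepAux, join, List.replicate_succ,
      List.head?_cons, List.tail_cons, update_join_right, update_join_left, update_join_middle,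
      Option.isSome_some, cond_true, gotoCtl, Function.update_self, Function.update_idem]

theorem reaches_header (flag : Bool) (out : List (tm₁.Γ tm₁.k₁)) (C : List (tm₂.Γ tm₂.k₁)) :
    ReachesIn (step (prependProg tm₁ tm₂ t₁ t₂ one o c ps)) 1
      (ctlCfg .header flag (only tm₁.k₁ out) (only tm₂.k₁ C) [])
      (ctlCfg .loop flag (only tm₁.k₁ (c.map o ++ out)) (only tm₂.k₁ C) []) := by
  refine .single ?_
  simp only [ctlCfg, step, prependProg, prependCtl, stepAux_pushList, gotoCtl, stepAux,
    update_join_left, join, only, Function.update_self, Function.update_idem]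

theorem reaches_up (i : ℕ) (hi : i + 1 < ps.length + 1) (flag : Bool)
    (out : List (tm₁.Γ tm₁.k₁)) (a b : ℕ) :
    ReachesIn (step (prependProg tm₁ tm₂ t₁ t₂ one o c ps)) (a + 1)
      (ctlCfg (.up ⟨i + 1, hi⟩) flag (only tm₁.k₁ out) (only tm₂.k₁ (List.replicate a one))
        (List.replicate b true))
      (ctlCfg (.down ⟨i + 1, hi⟩) false (only tm₁.k₁ (List.replicate a (o .tick) ++ out))
        (only tm₂.k₁ []) (List.replicate (a + b) true)) := by
  induction a generalizing flag out b with
  | zero =>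
    refine .single ?_
    simp only [ctlCfg, step, prependProg, prependCtl, popFlag, stepAux, join, List.replicate_zero,
      List.head?_nil, List.tail_nil, update_join_middle, Option.isSome_none, cond_false,
      Nat.zero_add, gotoCtl, only, Function.update_self, Function.update_idem, List.nil_append]
  | succ a ih =>
    refine .head ?_ (by
      have := ih true (o .tick :: out) (b + 1)
      rwa [show a + (b + 1) = a + 1 + b by omega, List.append_cons, ← List.replicate_succ'] at this)
    simp only [ctlCfg, step, prependProg, prependCtl, popFlag, stepAux, join, List.replicate_succ,
      List.head?_cons, List.tail_cons, update_join_right, update_join_left, update_join_middle,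
      Option.isSome_some, cond_true, gotoCtl, only, Function.update_self, Function.update_idem]

theorem reaches_down (i : ℕ) (hi : i + 1 < ps.length + 1) (flag : Bool)
    (out : List (tm₁.Γ tm₁.k₁)) (a b : ℕ) :
    ReachesIn (step (prependProg tm₁ tm₂ t₁ t₂ one o c ps)) (b + 1)
      (ctlCfg (.down ⟨i + 1, hi⟩) flag (only tm₁.k₁ out) (only tm₂.k₁ (List.replicate a one))
        (List.replicate b true))
      (ctlCfg (.up ⟨i, Nat.lt_of_succ_lt hi⟩) false
        (only tm₁.k₁ ((ps[i]'(Nat.lt_of_succ_lt_succ hi)).map o ++ out))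
        (only tm₂.k₁ (List.replicate (b + a) one)) []) := by
  induction b generalizing flag a with
  | zero =>
    refine .single ?_
    simp only [ctlCfg, step, prependProg, prependCtl, popFlag, stepAux, join, List.replicate_zero,
      List.head?_nil, List.tail_nil, update_join_left, update_join_right, Option.isSome_none,
      cond_false, Nat.zero_add, gotoCtl, only, Function.update_self, Function.update_idem,
      stepAux_pushList]
  | succ b ih =>
    refine .head ?_ (by
      have := ih true (a + 1)
      rwa [show b + (a + 1) = b + 1 + a by omega] at this)
    simp only [ctlCfg, step, prependProg, prependCtl, popFlag, stepAux, join, List.replicate_succ,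
      List.head?_cons, List.tail_cons, update_join_right, update_join_middle,
      Option.isSome_some, cond_true, gotoCtl, only, Function.update_self, Function.update_idem]

/-- One pass of the loop from `up i` on writes the text of the first `i` elements of `ps`, last one
first. -/
theorem reaches_block (j i : ℕ) (hi : i < ps.length + 1) (flag : Bool)
    (out : List (tm₁.Γ tm₁.k₁)) :
    ∃ flag', ReachesIn (step (prependProg tm₁ tm₂ t₁ t₂ one o c ps)) (i * (2 * j + 2) + 1)
      (ctlCfg (.up ⟨i, hi⟩) flag (only tm₁.k₁ out) (only tm₂.k₁ (List.replicate j one)) [])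
      (ctlCfg .loop flag' (only tm₁.k₁ ((blockText (ps.take i) j).map o ++ out))
        (only tm₂.k₁ (List.replicate j one)) []) := by
  induction i generalizing flag out with
  | zero =>
    refine ⟨flag, ?_⟩
    rw [Nat.zero_mul]
    refine .single ?_
    rfl
  | succ i ih =>
    have hi' : i < ps.length := Nat.lt_of_succ_lt_succ hi
    have h1 := reaches_up t₁ t₂ one o c ps i hi flag out j 0
    have h2 := reaches_down t₁ t₂ one o c ps i hi false (List.replicate j (o .tick) ++ out) 0 j
    obtain ⟨flag', h3⟩ := ih (Nat.lt_of_succ_lt hi) false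
      ((ps[i]'hi').map o ++ (List.replicate j (o .tick) ++ out))
    refine ⟨flag', ?_⟩
    have h4 := (h1.trans h2).trans h3
    have e1 : j + 1 + (j + 1) + (i * (2 * j + 2) + 1) = (i + 1) * (2 * j + 2) + 1 := by ring
    have e2 : (blockText (ps.take (i + 1)) j).map o ++ out = (blockText (ps.take i) j).map o ++
        ((ps[i]'hi').map o ++ (List.replicate j (o .tick) ++ out)) := by
      rw [blockText, List.take_succ_eq_append_getElem hi', List.flatMap_append]
      simp [blockText]
    rw [e1] at h4
    rw [e2]
    exact h4

theorem reaches_loop (n : ℕ) (flag : Bool) (out : List (tm₁.Γ tm₁.k₁)) :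
    ∃ s ≤ n * (ps.length * (2 * n) + 2) + 1,
      ReachesIn (step (prependProg tm₁ tm₂ t₁ t₂ one o c ps)) s
        (ctlCfg .loop flag (only tm₁.k₁ out) (only tm₂.k₁ (List.replicate n one)) [])
        ⟨none, (tm₁.initialState, tm₂.initialState, false),
          join tm₁ tm₂ (only tm₁.k₁ ((loopText ps n).map o ++ out)) (fun _ => []) []⟩ := by
  induction n generalizing flag out with
  | zero =>
    refine ⟨1, by simp, .single ?_⟩
    simp [ctlCfg, step, prependProg, prependCtl, popFlag, stepAux, join, loopText,
      update_join_middle]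
  | succ n ih =>
    obtain ⟨flag', h1⟩ := reaches_block t₁ t₂ one o c ps n ps.length (Nat.lt_succ_self _) true out
    obtain ⟨s, hs, h2⟩ := ih flag' ((blockText ps n).map o ++ out)
    rw [List.take_length] at h1
    refine ⟨ps.length * (2 * n + 2) + 1 + s + 1, ?_,
      .head (b := ctlCfg (.up (Fin.last _)) true (only tm₁.k₁ out)
        (only tm₂.k₁ (List.replicate n one)) []) ?_ ?_⟩
    · nlinarith [Nat.zero_le (ps.length * n), Nat.zero_le ps.length]
    · simp only [ctlCfg, step, prependProg, prependCtl, popFlag, stepAux, join, List.replicate_succ,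
        List.head?_cons, List.tail_cons, update_join_middle, Option.isSome_some, cond_true, gotoCtl,
        only, Function.update_self, Function.update_idem]
    · have e : (loopText ps (n + 1)).map o ++ out
          = (loopText ps n).map o ++ ((blockText ps n).map o ++ out) := by
        simp [loopText, List.range_succ]
      rw [e]
      exact h1.trans h2

theorem cfg_ext {K : Type} {Γ : K → Type} {Λ σ : Type} {c d : Cfg Γ Λ σ} (h₁ : c.l = d.l)
    (h₂ : c.var = d.var) (h₃ : ∀ k, c.stk k = d.stk k) : c = d := by
  obtain ⟨l, v, S⟩ := c
  obtain ⟨l', v', S'⟩ := d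
  simp only at h₁ h₂ h₃
  obtain rfl : S = S' := funext h₃
  rw [h₁, h₂]

/-- The run of `tm₁` as a part of a run of the whole machine. -/
theorem reaches_left {n : ℕ} {s : List (tm₁.Γ tm₁.k₀)} {out : List (tm₁.Γ tm₁.k₁)}
    (h : ReachesIn tm₁.step n (initList tm₁ s) (haltList tm₁ out)) (S₂ : ∀ k, List (tm₂.Γ k))
    (flag : Bool) :
    ReachesIn (step (prependProg tm₁ tm₂ t₁ t₂ one o c ps)) n
      ⟨some (.inl tm₁.main), (tm₁.initialState, tm₂.initialState, flag),
        join tm₁ tm₂ (only tm₁.k₀ s) S₂ []⟩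
      ⟨some (.inr (.inl tm₂.main)), (tm₁.initialState, tm₂.initialState, flag),
        join tm₁ tm₂ (only tm₁.k₁ out) S₂ []⟩ := by
  have key := Shows.reachesIn (ι := Sum.inl) (Γ' := prependΓ tm₁ tm₂) (lab := Sum.inl)
    (exit := .inr (.inl tm₂.main)) (get := fun v : Prependσ tm₁ tm₂ => v.1)
    (set := fun a v => (a, v.2)) Sum.inl_injective (fun _ _ => rfl) (fun _ _ _ => rfl)
    (w := (tm₁.initialState, tm₂.initialState, flag)) (T := join tm₁ tm₂ (fun _ => []) S₂ [])
    (M := tm₁.m) (M' := prependProg tm₁ tm₂ t₁ t₂ one o c ps) (fun _ => rfl)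
    (c' := ⟨some (.inl tm₁.main), (tm₁.initialState, tm₂.initialState, flag),
        join tm₁ tm₂ (only tm₁.k₀ s) S₂ []⟩)
    (c := initList tm₁ s) (d := haltList tm₁ out) ?_ h
  · obtain ⟨d', hd, h1, h2, h3, h4⟩ := key
    convert hd using 1
    refine cfg_ext h1.symm h2.symm fun k => ?_
    rcases k with k | k | k
    · rw [h3, haltList_stk]; rfl
    · rw [h4 _ (by simp)]; rfl
    · rw [h4 _ (by simp)]; rfl
  · refine ⟨rfl, rfl, fun k => ?_, fun k hk => ?_⟩
    · rw [initList_stk]; rfl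
    · rcases k with k | k | k
      · exact absurd ⟨k, rfl⟩ hk
      · rfl
      · rfl

/-- The run of `tm₂` as a part of a run of the whole machine. -/
theorem reaches_middle {n : ℕ} {s : List (tm₂.Γ tm₂.k₀)} {out : List (tm₂.Γ tm₂.k₁)}
    (h : ReachesIn tm₂.step n (initList tm₂ s) (haltList tm₂ out)) (S₁ : ∀ k, List (tm₁.Γ k))
    (flag : Bool) :
    ReachesIn (step (prependProg tm₁ tm₂ t₁ t₂ one o c ps)) n
      ⟨some (.inr (.inl tm₂.main)), (tm₁.initialState, tm₂.initialState, flag),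
        join tm₁ tm₂ S₁ (only tm₂.k₀ s) []⟩
      (ctlCfg .header flag S₁ (only tm₂.k₁ out) []) := by
  have key := Shows.reachesIn (ι := fun k => Sum.inr (Sum.inl k)) (Γ' := prependΓ tm₁ tm₂)
    (lab := fun l => Sum.inr (Sum.inl l))
    (exit := .inr (.inr .header)) (get := fun v : Prependσ tm₁ tm₂ => v.2.1)
    (set := fun a v => (v.1, a, v.2.2)) (Sum.inr_injective.comp Sum.inl_injective)
    (fun _ _ => rfl) (fun _ _ _ => rfl)
    (w := (tm₁.initialState, tm₂.initialState, flag)) (T := join tm₁ tm₂ S₁ (fun _ => []) [])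
    (M := tm₂.m) (M' := prependProg tm₁ tm₂ t₁ t₂ one o c ps) (fun _ => rfl)
    (c' := ⟨some (.inr (.inl tm₂.main)), (tm₁.initialState, tm₂.initialState, flag),
        join tm₁ tm₂ S₁ (only tm₂.k₀ s) []⟩)
    (c := initList tm₂ s) (d := haltList tm₂ out) ?_ h
  · obtain ⟨d', hd, h1, h2, h3, h4⟩ := key
    convert hd using 1
    refine cfg_ext h1.symm h2.symm fun k => ?_
    rcases k with k | k | k
    · rw [h4 _ (by simp)]; rfl
    · exact ((h3 k).trans (by rw [haltList_stk]; rfl)).symm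
    · rw [h4 _ (by simp)]; rfl
  · refine ⟨rfl, rfl, fun k => ?_, fun k hk => ?_⟩
    · rw [initList_stk]; rfl
    · rcases k with k | k | k
      · rfl
      · exact absurd ⟨k, rfl⟩ hk
      · rfl

theorem initList_prependTM (s : List Bool) :
    initList (prependTM tm₁ tm₂ t₁ t₂ one o c ps) s
      = ctlCfg .fork false (only tm₁.k₀ []) (only tm₂.k₀ []) s := by
  refine cfg_ext rfl rfl fun k => (congrFun (initList_stk _ s) k).trans ?_
  rcases k with k | k | k
  · exact (Function.update_of_ne Sum.inl_ne_inr _ _).trans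
      (congrFun (Function.update_eq_self tm₁.k₀ (fun k => ([] : List (tm₁.Γ k)))).symm k)
  · exact (Function.update_of_ne (fun h => Sum.inl_ne_inr (Sum.inr_injective h)) _ _).trans
      (congrFun (Function.update_eq_self tm₂.k₀ (fun k => ([] : List (tm₂.Γ k)))).symm k)
  · exact Function.update_self (β := fun k => List (prependΓ tm₁ tm₂ k)) (Sum.inr (Sum.inr ())) s _

theorem haltList_prependTM (s : List (tm₁.Γ tm₁.k₁)) :
    haltList (prependTM tm₁ tm₂ t₁ t₂ one o c ps) s
      = ⟨none, (tm₁.initialState, tm₂.initialState, false),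
          join tm₁ tm₂ (only tm₁.k₁ s) (fun _ => []) []⟩ := by
  refine cfg_ext rfl rfl fun k => (congrFun (haltList_stk (prependTM tm₁ tm₂ t₁ t₂ one o c ps) s) k).trans ?_
  rcases k with k | k | k
  · by_cases h : k = tm₁.k₁
    · subst h
      exact (Function.update_self (β := fun k => List (prependΓ tm₁ tm₂ k)) (Sum.inl _) s _).trans
        (Function.update_self tm₁.k₁ s (fun k => ([] : List (tm₁.Γ k)))).symm
    · exact (Function.update_of_ne (fun e => h (Sum.inl_injective e)) _ _).trans
        (Function.update_of_ne (β := fun k => List (tm₁.Γ k)) h s (fun _ => [])).symm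
  · exact Function.update_of_ne Sum.inr_ne_inl _ _
  · exact Function.update_of_ne Sum.inr_ne_inl _ _

end Machine

/-- The length of a unary output is polynomially bounded. -/
theorem uniformSize_bounded {f : ℕ → ℕ}
    (h : TM2ComputableInPolyTime Computability.unaryEncodeNat Computability.unaryEncodeNat f) :
    ∃ C : ℕ, ∀ ℓ, f ℓ ≤ ℓ + h.time.eval ℓ * C := by
  let := h.tm.ΛFin
  refine ⟨∑ l, pushCount (h.tm.m l), fun ℓ => ?_⟩
  have hr := ReachesIn.iff_iterate.2 (h.outputsFun ℓ).evals_in_steps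
  have hs := (h.outputsFun ℓ).steps_le_m
  have hl := length_le_of_reachesIn hr h.tm.k₁
  have h1 : ((haltList h.tm (List.map h.outputAlphabet.invFun
      (Computability.unaryEncodeNat (f ℓ)))).stk h.tm.k₁).length = f ℓ := by
    rw [haltList_stk, unaryEncodeNat_eq_replicate]; simp
  have h2 : ((initList h.tm (List.map h.inputAlphabet.invFun
      (Computability.unaryEncodeNat ℓ))).stk h.tm.k₁).length ≤ ℓ := by
    rw [initList_stk, unaryEncodeNat_eq_replicate]
    by_cases e : h.tm.k₁ = h.tm.k₀
    · rw [e]; simp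
    · simp [Function.update_of_ne e]
  rw [h1] at hl
  have h3 : (Computability.unaryEncodeNat ℓ).length = ℓ := by
    rw [unaryEncodeNat_eq_replicate]; simp
  replace hs : (h.outputsFun ℓ).steps ≤ h.time.eval ℓ := hs.trans_eq (by rw [h3])
  exact hl.trans (Nat.add_le_add h2 (Nat.mul_le_mul_right _ hs))

/-- The families of texts that a Turing machine writes in polynomial time from `1^ℓ`. -/
def UniformText (L : ℕ → List Sym) : Prop :=
  Nonempty (TM2ComputableInPolyTime Computability.unaryEncodeNat (id : List Sym → List Sym) L)

/-- A loop of polynomially many passes and a constant text can be written in front of a uniform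
family. The machine is `prependTM`; the number of passes is polynomially bounded because it is written
in unary in polynomial time. -/
theorem UniformText.prepend {L : ℕ → List Sym} (hL : UniformText L) {f : ℕ → ℕ}
    (hf : UniformSize f) (c : List Sym) (ps : List (List Sym)) :
    UniformText fun ℓ => loopText ps (f ℓ) ++ (c ++ L ℓ) := by
  obtain ⟨h₁⟩ := hL
  obtain ⟨h₂⟩ := hf
  obtain ⟨C, hC⟩ := uniformSize_bounded h₂
  -- `B` bounds the number of passes of the loop
  let B : Polynomial ℕ := Polynomial.X + h₂.time * Polynomial.C C
  refine ⟨{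
    tm := prependTM h₁.tm h₂.tm (h₁.inputAlphabet.invFun true) (h₂.inputAlphabet.invFun true)
      (h₂.outputAlphabet.invFun true) h₁.outputAlphabet.invFun c ps
    inputAlphabet := Equiv.refl Bool
    outputAlphabet := h₁.outputAlphabet
    time := Polynomial.X + 1 + h₁.time + h₂.time + 1
      + (B * (Polynomial.C ps.length * (2 * B) + 2) + 1)
    outputsFun := fun ℓ => Nonempty.some ?_ }⟩
  have r₁ := ReachesIn.iff_iterate.2 (h₁.outputsFun ℓ).evals_in_steps
  have s₁ := (h₁.outputsFun ℓ).steps_le_m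
  have r₂ := ReachesIn.iff_iterate.2 (h₂.outputsFun ℓ).evals_in_steps
  have s₂ := (h₂.outputsFun ℓ).steps_le_m
  simp only [unaryEncodeNat_eq_replicate, List.map_replicate, List.length_replicate, id]
    at r₁ s₁ r₂ s₂ ⊢
  set t₁ := h₁.inputAlphabet.invFun true
  set t₂ := h₂.inputAlphabet.invFun true
  set one := h₂.outputAlphabet.invFun true
  set o := h₁.outputAlphabet.invFun
  have q₁ := reaches_fork (tm₁ := h₁.tm) (tm₂ := h₂.tm) t₁ t₂ one o c ps ℓ false 0 0
  have q₂ := reaches_left t₁ t₂ one o c ps r₁ (only h₂.tm.k₀ (List.replicate (ℓ + 0) t₂)) false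
  have q₃ := reaches_middle t₁ t₂ one o c ps r₂ (only h₁.tm.k₁ ((L ℓ).map o)) false
  have q₄ := reaches_header t₁ t₂ one o c ps false ((L ℓ).map o) (List.replicate (f ℓ) one)
  obtain ⟨s, hs, q₅⟩ := reaches_loop t₁ t₂ one o c ps (f ℓ) false (c.map o ++ (L ℓ).map o)
  have q := (((q₁.trans q₂).trans q₃).trans q₄).trans q₅
  refine ⟨⟨⟨ℓ + 1 + (h₁.outputsFun ℓ).steps + (h₂.outputsFun ℓ).steps + 1 + s, ?_⟩, ?_⟩⟩
  · have e := haltList_prependTM (tm₂ := h₂.tm) t₁ t₂ one o c ps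
      ((loopText ps (f ℓ) ++ (c ++ L ℓ)).map o)
    have e' : (loopText ps (f ℓ) ++ (c ++ L ℓ)).map o
        = (loopText ps (f ℓ)).map o ++ (c.map o ++ (L ℓ).map o) := by simp
    rw [congrArg (only h₁.tm.k₁) e'] at e
    exact (congrArg _ (congrArg some (initList_prependTM t₁ t₂ one o c ps _))).trans
      ((ReachesIn.iff_iterate.1 q).trans (congrArg some e.symm))
  · have hb : f ℓ ≤ B.eval ℓ := by simpa [B] using hC ℓ
    have hm : f ℓ * (ps.length * (2 * f ℓ) + 2) + 1
        ≤ B.eval ℓ * (ps.length * (2 * B.eval ℓ) + 2) + 1 := by gcongr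
    simp only [Polynomial.eval_add, Polynomial.eval_mul, Polynomial.eval_X, Polynomial.eval_one,
      Polynomial.eval_C, Polynomial.eval_ofNat]
    omega

/-- The alphabets of the stacks of `eraseTM`. -/
abbrev eraseΓ : Bool → Type
  | false => Bool
  | true => Sym

/-- The machine that erases its unary input and writes nothing. -/
def eraseTM : FinTM2 where
  K := Bool
  k₀ := false
  k₁ := true
  Γ := eraseΓ
  Λ := Unit
  main := ()
  σ := Bool
  initialState := false
  Γk₀Fin := inferInstanceAs (Fintype Bool)
  m _ := .pop false (fun _ x => x.isSome) <| .branch id (.goto fun _ => ()) .halt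

/-- The stacks of `eraseTM`. -/
def eraseStk (l : List Bool) : ∀ k, List (eraseΓ k)
  | false => l
  | true => []

theorem UniformText.empty : UniformText fun _ => [] := by
  have key : ∀ (n : ℕ) (flag : Bool),
      ReachesIn eraseTM.step (n + 1) ⟨some (), flag, eraseStk (List.replicate n true)⟩
        ⟨none, false, eraseStk []⟩ := by
    intro n
    induction n with
    | zero =>
      intro flag
      exact .single (congrArg some (cfg_ext rfl rfl (by rintro (_ | _) <;> rfl)))
    | succ n ih =>
      intro flag
      exact .head (b := ⟨some (), true, eraseStk (List.replicate n true)⟩)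
        (congrArg some (cfg_ext rfl rfl (by rintro (_ | _) <;> rfl))) (ih true)
  refine ⟨{
    tm := eraseTM
    inputAlphabet := Equiv.refl Bool
    outputAlphabet := Equiv.refl Sym
    time := Polynomial.X + 1
    outputsFun := fun ℓ => ⟨⟨ℓ + 1, ?_⟩, ?_⟩ }⟩
  · refine Eq.trans ?_ ((ReachesIn.iff_iterate.1 (key ℓ false)).trans ?_)
    · rw [unaryEncodeNat_eq_replicate, List.map_replicate]
      exact congrArg _ (congrArg some (cfg_ext rfl rfl (by rintro (_ | _) <;> rfl)))
    · exact congrArg some (cfg_ext rfl rfl (by rintro (_ | _) <;> rfl))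
  · simp [unaryEncodeNat_eq_replicate]

/-! ### Linearity and unitarity of circuits -/

section Unitary

variable {W : Type} [DecidableEq W]

theorem run_nil (ψ : State W) : run [] ψ = ψ := rfl

theorem run_cons (g : Gate W) (C : List (Gate W)) (ψ : State W) :
    run (g :: C) ψ = run C (g.apply ψ) := rfl

theorem run_append (C D : List (Gate W)) (ψ : State W) :
    run (C ++ D) ψ = run D (run C ψ) := by
  simp [run, List.foldl_append]

theorem Gate.apply_add (g : Gate W) (φ ψ : State W) : g.apply (φ + ψ) = g.apply φ + g.apply ψ := by
  funext s
  cases g <;> simp only [Gate.apply, Pi.add_apply] <;> ring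

theorem Gate.apply_smul (g : Gate W) (c : ℂ) (ψ : State W) : g.apply (c • ψ) = c • g.apply ψ := by
  funext s
  cases g <;> simp only [Gate.apply, Pi.smul_apply, smul_eq_mul] <;> ring

/-- A circuit as a linear map. -/
noncomputable def runLin (C : List (Gate W)) : State W →ₗ[ℂ] State W where
  toFun := run C
  map_add' φ ψ := by
    induction C generalizing φ ψ with
    | nil => rfl
    | cons g C ih => rw [run_cons, Gate.apply_add, ih]; rfl
  map_smul' c ψ := by
    induction C generalizing ψ with
    | nil => rfl
    | cons g C ih => rw [run_cons, Gate.apply_smul, ih]; rfl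

/-- A measurement outcome as a linear map. -/
noncomputable def projectLin (p : (W → Bool) → Prop) : State W →ₗ[ℂ] State W where
  toFun := project p
  map_add' φ ψ := by funext s; by_cases h : p s <;> simp [project, h]
  map_smul' c ψ := by funext s; by_cases h : p s <;> simp [project, h]

theorem update_xor_involutive (i : W) (c : (W → Bool) → Bool)
    (hc : ∀ s b, c (Function.update s i b) = c s) :
    Function.Involutive fun s : W → Bool => Function.update s i (xor (s i) (c s)) := by
  intro s
  simp [hc]

variable [Fintype W]

theorem weight_comp_involutive {f : (W → Bool) → (W → Bool)} (hf : Function.Involutive f)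
    (ψ : State W) : weight (fun s => ψ (f s)) = weight ψ :=
  Equiv.sum_comp hf.toPerm (fun s => ‖ψ s‖ ^ 2)

theorem weight_phase {c : (W → Bool) → ℂ} (hc : ∀ s, ‖c s‖ = 1) (ψ : State W) :
    weight (fun s => c s * ψ s) = weight ψ := by
  simp [weight, hc]

theorem weight_hadamard (i : W) (ψ : State W) : weight ((Gate.H i).apply ψ) = weight ψ := by
  have hinv : Function.Involutive fun s : W → Bool => Function.update s i (!(s i)) := by
    intro s; simp
  -- the two basis states that differ in the wire `i` are treated together
  have key : ∀ s : W → Bool, ‖(Gate.H i).apply ψ s‖ ^ 2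
      + ‖(Gate.H i).apply ψ (Function.update s i (!(s i)))‖ ^ 2
      = ‖ψ s‖ ^ 2 + ‖ψ (Function.update s i (!(s i)))‖ ^ 2 := by
    intro s
    have h2 : ‖(1 / (Real.sqrt 2 : ℂ))‖ ^ 2 = 1 / 2 := by
      rw [norm_div, norm_one, Complex.norm_real, Real.norm_of_nonneg (Real.sqrt_nonneg 2), div_pow,
        Real.sq_sqrt zero_le_two, one_pow]
    have par := parallelogram_law_with_norm ℝ (ψ (Function.update s i false))
      (ψ (Function.update s i true))
    cases hs : s i
    · have e : Function.update s i false = s := by rw [← hs]; simp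
      simp only [Gate.apply, norm_mul, mul_pow, h2, hs, Bool.not_false, Function.update_idem,
        Function.update_self, if_true, Bool.false_eq_true, if_false, one_mul, neg_mul,
        ← sub_eq_add_neg]
      rw [e] at par ⊢
      linarith
    · have e : Function.update s i true = s := by rw [← hs]; simp
      simp only [Gate.apply, norm_mul, mul_pow, h2, hs, Bool.not_true, Function.update_idem,
        Function.update_self, if_true, Bool.false_eq_true, if_false, one_mul, neg_mul,
        ← sub_eq_add_neg]
      rw [e] at par ⊢
      linarith
  have h1 := Finset.sum_congr (rfl : (Finset.univ : Finset (W → Bool)) = _) fun s _ => key s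
  rw [Finset.sum_add_distrib, Finset.sum_add_distrib] at h1
  have h2 := weight_comp_involutive hinv ψ
  have h3 := weight_comp_involutive hinv ((Gate.H i).apply ψ)
  simp only [weight] at h2 h3 ⊢
  linarith

/-- Gates are unitary. -/
theorem weight_apply (g : Gate W) (ψ : State W) : weight (g.apply ψ) = weight ψ := by
  cases g with
  | X i =>
    refine weight_comp_involutive (f := fun s => Function.update s i (!(s i))) ?_ ψ
    intro s; simp
  | H i => exact weight_hadamard i ψ
  | T i =>
    refine weight_phase (fun s => ?_) ψ
    split_ifs
    · rw [show (Real.pi / 4 * Complex.I : ℂ) = ((Real.pi / 4 : ℝ) : ℂ) * Complex.I by push_cast; rfl,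
        Complex.norm_exp_ofReal_mul_I]
    · exact norm_one
  | CNOT i j hij =>
    exact weight_comp_involutive (update_xor_involutive j (fun s => s i)
      (fun s b => Function.update_of_ne hij _ _)) ψ
  | CS i j hij =>
    refine weight_phase (fun s => ?_) ψ
    split_ifs <;> simp
  | CCX i j l hij hil hjl =>
    exact weight_comp_involutive (update_xor_involutive l (fun s => s i && s j)
      (fun s b => by rw [Function.update_of_ne hil, Function.update_of_ne hjl])) ψ

theorem weight_run (C : List (Gate W)) (ψ : State W) : weight (run C ψ) = weight ψ := by
  induction C generalizing ψ with
  | nil => rfl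
  | cons g C ih => rw [run_cons, ih, weight_apply]

theorem weight_basis (s : W → Bool) : weight (basis s) = 1 := by
  have : ∀ s', ‖basis s s'‖ ^ 2 = if s' = s then (1 : ℝ) else 0 := by
    intro s'
    by_cases h : s' = s <;> simp [basis, h]
  simp [weight, this]

/-- The outcome probabilities of a measurement add up. -/
theorem sum_weight_project {α : Type} [Fintype α] (f : (W → Bool) → α) (ψ : State W) :
    ∑ a, weight (project (fun s => f s = a) ψ) = weight ψ := by
  classical
  simp only [weight]
  rw [Finset.sum_comm]
  refine Finset.sum_congr rfl fun s _ => ?_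
  rw [Fintype.sum_eq_single (f s)]
  · simp [project]
  · intro a ha
    simp [project, ha.symm]

theorem weight_eq_zero {ψ : State W} : weight ψ = 0 ↔ ψ = 0 := by
  rw [weight, Finset.sum_eq_zero_iff_of_nonneg (fun _ _ => by positivity)]
  constructor
  · intro h
    funext s
    simpa using h s (Finset.mem_univ s)
  · rintro rfl
    simp

/-- Hadamard gates on distinct wires in the state `|0⟩` prepare the uniform superposition. -/
theorem run_hadamards (s₀ : W → Bool) (L : List W) (hL : L.Nodup) (h₀ : ∀ i ∈ L, s₀ i = false)
    (s : W → Bool) :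
    run (L.map Gate.H) (basis s₀) s
      = if ∀ i, i ∉ L → s i = s₀ i then (1 / (Real.sqrt 2 : ℂ)) ^ L.length else 0 := by
  induction L using List.reverseRecOn generalizing s with
  | nil => simp [run_nil, basis, funext_iff]
  | append_singleton L i ih =>
    rw [List.nodup_append] at hL
    have hi : i ∉ L := fun h => hL.2.2 i h i (by simp) rfl
    have ih := ih hL.1 (fun j hj => h₀ j (by simp [hj]))
    have hsi : s₀ i = false := h₀ i (by simp)
    rw [List.map_append, run_append, List.map_singleton, run_cons, run_nil]
    simp only [Gate.apply, ih]
    have h1 : ¬ ∀ j, j ∉ L → Function.update s i true j = s₀ j := by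
      intro h
      have := h i hi
      simp [hsi] at this
    have h2 : (∀ j, j ∉ L → Function.update s i false j = s₀ j) ↔
        ∀ j, j ∉ L ++ [i] → s j = s₀ j := by
      constructor
      · intro h j hj
        simp only [List.mem_append, List.mem_singleton, not_or] at hj
        simpa [hj.2] using h j hj.1
      · intro h j hj
        by_cases e : j = i
        · subst e; simp [hsi]
        · rw [Function.update_of_ne e]
          exact h j (by simp [hj, e])
    rw [if_neg h1, mul_zero, add_zero]
    by_cases h : ∀ j, j ∉ L ++ [i] → s j = s₀ j
    · rw [if_pos (h2.2 h), if_pos h, List.length_append, List.length_singleton, pow_succ, mul_comm]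
    · rw [if_neg (fun e => h (h2.1 e)), if_neg h, mul_zero]

end Unitary

/-! ### The circuits of the honest prover -/

section Circuits

variable {m ω r a : ℕ}

/-- One loop of gates over the digits, as a circuit. -/
def digitLoop (body : Fin ω → Circuit m ω r a) : Circuit m ω r a :=
  (List.finRange ω).flatMap body

theorem encodeCircuit_append (C D : Circuit m ω r a) :
    encodeCircuit (C ++ D) = encodeCircuit C ++ encodeCircuit D := by
  simp [encodeCircuit]

theorem encodeCircuit_digitLoop (body : Fin ω → Circuit m ω r a) (ps : List (List Sym))
    (h : ∀ j, encodeCircuit (body j) = blockText ps j) :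
    encodeCircuit (digitLoop body) = loopText ps ω := by
  have h' : ∀ L : List (Fin ω), encodeCircuit (L.flatMap body)
      = (L.map Fin.val).flatMap (blockText ps) := by
    intro L
    induction L with
    | nil => rfl
    | cons j L ih => rw [List.flatMap_cons, encodeCircuit_append, ih, h]; rfl
  rw [digitLoop, h', List.map_coe_finRange_eq_range, loopText]

end Circuits

/-- A loop of a fixed sequence of gates over the digits, followed by a constant circuit, can be put in
front of a uniform family of circuits. -/
theorem UniformCircuit.loop {m ω r a : ℕ → ℕ} (hω : UniformSize ω)
    (body : ∀ ℓ, Fin (ω ℓ) → Circuit (m ℓ) (ω ℓ) (r ℓ) (a ℓ)) (ps : List (List Sym))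
    (hbody : ∀ ℓ j, encodeCircuit (body ℓ j) = blockText ps j)
    (head : ∀ ℓ, Circuit (m ℓ) (ω ℓ) (r ℓ) (a ℓ)) (c : List Sym)
    (hhead : ∀ ℓ, encodeCircuit (head ℓ) = c)
    {tail : ∀ ℓ, Circuit (m ℓ) (ω ℓ) (r ℓ) (a ℓ)} (htail : UniformCircuit tail) :
    UniformCircuit fun ℓ => digitLoop (body ℓ) ++ (head ℓ ++ tail ℓ) := by
  have h := UniformText.prepend htail hω c ps
  have e : (fun ℓ => encodeCircuit (digitLoop (body ℓ) ++ (head ℓ ++ tail ℓ)))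
      = fun ℓ => loopText ps (ω ℓ) ++ (c ++ encodeCircuit (tail ℓ)) := by
    funext ℓ
    rw [encodeCircuit_append, encodeCircuit_append, encodeCircuit_digitLoop _ _ (hbody ℓ), hhead]
  rw [UniformCircuit, e]
  exact h

theorem UniformCircuit.empty {m ω r a : ℕ → ℕ} :
    UniformCircuit fun ℓ => ([] : Circuit (m ℓ) (ω ℓ) (r ℓ) (a ℓ)) := UniformText.empty

theorem UniformCircuit.loop_const {m ω r a : ℕ → ℕ} (hω : UniformSize ω)
    (body : ∀ ℓ, Fin (ω ℓ) → Circuit (m ℓ) (ω ℓ) (r ℓ) (a ℓ)) (ps : List (List Sym))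
    (hbody : ∀ ℓ j, encodeCircuit (body ℓ j) = blockText ps j)
    (head : ∀ ℓ, Circuit (m ℓ) (ω ℓ) (r ℓ) (a ℓ)) (c : List Sym)
    (hhead : ∀ ℓ, encodeCircuit (head ℓ) = c) :
    UniformCircuit fun ℓ => digitLoop (body ℓ) ++ head ℓ := by
  have h := UniformCircuit.loop hω body ps hbody head c hhead UniformCircuit.empty
  simpa using h

theorem UniformCircuit.const {m ω r a : ℕ → ℕ} (hω : UniformSize ω)
    (head : ∀ ℓ, Circuit (m ℓ) (ω ℓ) (r ℓ) (a ℓ)) (c : List Sym)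
    (hhead : ∀ ℓ, encodeCircuit (head ℓ) = c) : UniformCircuit head := by
  have h := UniformCircuit.loop_const hω (fun ℓ _ => ([] : Circuit (m ℓ) (ω ℓ) (r ℓ) (a ℓ))) []
    (fun _ _ => rfl) head c hhead
  simpa [digitLoop, List.flatMap_eq_nil_iff.2] using h

section Circuits

variable {m ω r a : ℕ}

/-- The Fourier transform over `ℤ/4` on one digit of the domain register, followed by a copy of the
result to the equation register. The transform leaves the low bit of the result on the wire of the
high bit of the argument and vice versa. -/
def fourierBody (j : Fin ω) : Circuit m ω r a :=
  [.H (.xhi j), .CS (.xhi j) (.xlo j) (by simp), .H (.xlo j),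
    .CNOT (.xhi j) (.dlo j) (by simp), .CNOT (.xlo j) (.dhi j) (by simp)]

/-- The number of `T` gates, i.e. rotations by `π/4`, that turn the given equatorial basis into the
basis `X`. -/
def rotation : Basis → ℕ
  | .X => 0
  | .XminusY => 1
  | .Y => 6
  | .XplusY => 7
  | .Z => 0

/-- The measurement of the qubit `b` in the given basis, the outcome being written to `v`. -/
def answerCircuit (c : Basis) : Circuit m ω r a :=
  List.replicate (rotation c) (.T .b) ++ ((if c = .Z then [] else [.H .b]) ++
    [.CNOT .b .v (by simp)])

/-- The preparation of a uniform superposition of all `(b, x)`, followed by the circuit `C`. -/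
def commitCircuit (C : Circuit m ω r a) : Circuit m ω r a :=
  digitLoop (fun j => [.H (.xlo j), .H (.xhi j)]) ++ ([.H .b] ++ C)

/-- The measurement of the domain register in the Fourier basis over `ℤ/4`, up to the final
computational basis measurement of the equation register. -/
def equationCircuit : Circuit m ω r a := digitLoop fourierBody

end Circuits

theorem encodeCircuit_replicate {m ω r a : ℕ} (n : ℕ) (g : Gate (Wire m ω r a)) :
    encodeCircuit (List.replicate n g) = (List.replicate n (encodeGate g)).flatten := by
  simp [encodeCircuit, List.flatMap]

theorem uniformCircuit_commitCircuit {m ω r a : ℕ → ℕ} (hω : UniformSize ω)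
    {C : ∀ ℓ, Circuit (m ℓ) (ω ℓ) (r ℓ) (a ℓ)} (hC : UniformCircuit C) :
    UniformCircuit fun ℓ => commitCircuit (C ℓ) :=
  UniformCircuit.loop hω _ [[.gH, .rXlo], [.gH, .rXhi]]
    (fun ℓ j => by simp [encodeCircuit, encodeGate, encodeWire, blockText]) _ [.gH, .rB]
    (fun ℓ => by simp [encodeCircuit, encodeGate, encodeWire]) hC

theorem uniformCircuit_equationCircuit {m ω r a : ℕ → ℕ} (hω : UniformSize ω) :
    UniformCircuit fun ℓ => (equationCircuit : Circuit (m ℓ) (ω ℓ) (r ℓ) (a ℓ)) := by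
  have h := UniformCircuit.loop_const (m := m) (r := r) (a := a) hω
    (fun _ => fourierBody)
    [[.gH, .rXhi], [.gCS, .rXhi], [.rXlo], [.gH, .rXlo], [.gCNOT, .rXhi], [.rDlo],
      [.gCNOT, .rXlo], [.rDhi]]
    (fun ℓ j => by simp [fourierBody, encodeCircuit, encodeGate, encodeWire, blockText])
    (fun _ => []) [] (fun _ => rfl)
  simpa [equationCircuit] using h

theorem uniformCircuit_answerCircuit {m ω r a : ℕ → ℕ} (hω : UniformSize ω) (c : Basis) :
    UniformCircuit fun ℓ => (answerCircuit c : Circuit (m ℓ) (ω ℓ) (r ℓ) (a ℓ)) := by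
  refine UniformCircuit.const hω _
    ((List.replicate (rotation c) [.gT, .rB]).flatten ++
      ((if c = .Z then [] else [.gH, .rB]) ++ [.gCNOT, .rB, .rV])) fun ℓ => ?_
  simp only [answerCircuit, encodeCircuit_append, encodeCircuit_replicate]
  congr 2
  split_ifs <;> rfl

/-- The honest prover. It evaluates the function in uniform superposition and returns the image. In
the preimage test it measures the preimage registers. In the measurement test it measures the domain
register in the Fourier basis over `ℤ/4`, and then the qubit `b` in the requested basis. -/
abbrev honest (F : TrapdoorFamilies) : Prover F where
  a := F.a
  commit ℓ := commitCircuit (F.eval ℓ)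
  preimage _ := []
  equation _ := equationCircuit
  answer c _ := answerCircuit c

theorem honest_isQPT (F : TrapdoorFamilies) : (honest F).IsQPT :=
  ⟨F.uniform_a, uniformCircuit_commitCircuit F.uniform_ω F.uniform_eval, UniformCircuit.empty,
    uniformCircuit_equationCircuit F.uniform_ω, uniformCircuit_answerCircuit F.uniform_ω⟩

/-! ### The Fourier transform over `ℤ/4` -/

/-- The character `t ↦ i^t` of `ℤ/4`. -/
noncomputable def iPow (t : ZMod 4) : ℂ := Complex.I ^ t.val

theorem iPow_zero : iPow 0 = 1 := by simp [iPow]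

theorem iPow_add (s t : ZMod 4) : iPow (s + t) = iPow s * iPow t := by
  rw [iPow, iPow, iPow, ← pow_add, ZMod.val_add, ← Complex.I_pow_eq_pow_mod]

theorem iPow_sum {ι : Type} (S : Finset ι) (f : ι → ZMod 4) :
    iPow (∑ i ∈ S, f i) = ∏ i ∈ S, iPow (f i) := by
  classical
  induction S using Finset.induction_on with
  | empty => simp [iPow_zero]
  | insert i S hi ih => rw [Finset.sum_insert hi, Finset.prod_insert hi, iPow_add, ih]

theorem norm_iPow (t : ZMod 4) : ‖iPow t‖ = 1 := by simp [iPow]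

theorem iPow_ne_zero (t : ZMod 4) : iPow t ≠ 0 := by simp [iPow]

theorem digit_bits (t : ZMod 4) : digit (bitW t, bitV t) = t := by
  revert t; decide

theorem bits_digit (p q : Bool) : bitW (digit (p, q)) = p ∧ bitV (digit (p, q)) = q := by
  revert p q; decide

section Fourier

variable {m ω r a : ℕ}

/-- A state that is a product of one factor for each digit, a function of the bits of the domain and
the equation register at that digit, and of one factor for all the other wires. -/
noncomputable def digitState
    (E : (Fin m → Bool) → Bool → (Fin r → Bool) → Bool → Bool → (Fin a → Bool) → ℂ)
    (φ : Fin ω → Bool → Bool → Bool → Bool → ℂ) : State (Wire m ω r a) := fun s =>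
  E (fun i => s (.key i)) (s .b) (fun i => s (.y i)) (s .w) (s .v) (fun i => s (.anc i)) *
    ∏ j, φ j (s (.xlo j)) (s (.xhi j)) (s (.dlo j)) (s (.dhi j))

/-- The factor of a digit with value `x` in the domain register and `0` in the equation register. -/
noncomputable def factorIn (x : Bool × Bool) (p q u w : Bool) : ℂ :=
  if p = x.1 ∧ q = x.2 ∧ u = false ∧ w = false then 1 else 0

/-- The factor of a digit after the Fourier transform. -/
noncomputable def factorOut (x : Bool × Bool) (p q u w : Bool) : ℂ :=
  if u = q ∧ w = p then 1 / 2 * iPow (digit (u, w) * digit x) else 0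

theorem inv_sqrt_two_mul_self : (1 / (Real.sqrt 2 : ℂ)) * (1 / (Real.sqrt 2 : ℂ)) = 1 / 2 := by
  rw [div_mul_div_comm, ← Complex.ofReal_mul, Real.mul_self_sqrt zero_le_two]
  norm_num

/-- The gates of `fourierBody`, in terms of the four bits at one digit. -/
theorem factorOut_eq (x : Bool × Bool) (p q u w : Bool) :
    (1 / (Real.sqrt 2 : ℂ)) * (1 / (Real.sqrt 2 : ℂ)) *
      ((factorIn x false false (xor u q) (xor w p)
          + (if q then -1 else 1) * factorIn x false true (xor u q) (xor w p))
        + (if p then -1 else 1) * ((if q then Complex.I else 1) *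
          (factorIn x true false (xor u q) (xor w p)
            + (if q then -1 else 1) * factorIn x true true (xor u q) (xor w p))))
      = factorOut x p q u w := by
  rw [inv_sqrt_two_mul_self]
  have h2 : iPow 2 = -1 := by simp [iPow, show (2 : ZMod 4).val = 2 from rfl]
  have h1 : iPow 1 = Complex.I := by simp [iPow, show (1 : ZMod 4).val = 1 from rfl]
  have h3 : iPow 3 = -Complex.I := by
    rw [show (3 : ZMod 4) = 2 + 1 from rfl, iPow_add, h1, h2]; ring
  have h4 : iPow 4 = 1 := iPow_zero
  have h6 : iPow 6 = -1 := h2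
  have h9 : iPow 9 = Complex.I := h1
  obtain ⟨x₁, x₂⟩ := x
  cases x₁ <;> cases x₂ <;> cases p <;> cases q <;> cases u <;> cases w <;>
    norm_num [factorIn, factorOut, digit, h1, h2, h3, h4, h6, h9, iPow_zero]

theorem run_fourierBody
    (E : (Fin m → Bool) → Bool → (Fin r → Bool) → Bool → Bool → (Fin a → Bool) → ℂ)
    (φ : Fin ω → Bool → Bool → Bool → Bool → ℂ) (j : Fin ω) (x : Bool × Bool)
    (hj : φ j = factorIn x) :
    run (fourierBody j) (digitState E φ)
      = digitState E (Function.update φ j (factorOut x)) := by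
  funext s
  set e : ℂ := E (fun i => s (.key i)) (s .b) (fun i => s (.y i)) (s .w) (s .v)
    (fun i => s (.anc i)) with he
  set R : ℂ := ∏ i ∈ Finset.univ.erase j, φ i (s (.xlo i)) (s (.xhi i)) (s (.dlo i)) (s (.dhi i))
    with hR
  have hL : ∀ p q u w : Bool, digitState E φ (Function.update (Function.update (Function.update
      (Function.update s (.dhi j) w) (.dlo j) u) (.xlo j) p) (.xhi j) q)
      = e * R * factorIn x p q u w := by
    intro p q u w
    have hprod : ∀ s' : Wire m ω r a → Bool, (∀ i, i ≠ j → s' (.xlo i) = s (.xlo i) ∧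
        s' (.xhi i) = s (.xhi i) ∧ s' (.dlo i) = s (.dlo i) ∧ s' (.dhi i) = s (.dhi i)) →
        ∏ i ∈ Finset.univ.erase j, φ i (s' (.xlo i)) (s' (.xhi i)) (s' (.dlo i)) (s' (.dhi i))
          = R := by
      intro s' hs'
      refine Finset.prod_congr rfl fun i hi => ?_
      obtain ⟨h1, h2, h3, h4⟩ := hs' i (Finset.ne_of_mem_erase hi)
      rw [h1, h2, h3, h4]
    simp only [digitState]
    rw [← Finset.mul_prod_erase _ _ (Finset.mem_univ j), hj,
      hprod _ (fun i hi => by simp [hi])]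
    simp only [ne_eq, reduceCtorEq, not_false_eq_true, Function.update_of_ne, Function.update_self]
    rw [he]
    ring
  have hR' : digitState E (Function.update φ j (factorOut x)) s
      = e * R * factorOut x (s (.xlo j)) (s (.xhi j)) (s (.dlo j)) (s (.dhi j)) := by
    simp only [digitState]
    rw [← Finset.mul_prod_erase _ _ (Finset.mem_univ j), Function.update_self,
      Finset.prod_congr rfl (fun i hi => by rw [Function.update_of_ne (Finset.ne_of_mem_erase hi)])]
    rw [he, hR]
    ring
  rw [hR']
  simp only [fourierBody, run, List.foldl_cons, List.foldl_nil, Gate.apply, ne_eq, reduceCtorEq,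
    not_false_eq_true, Function.update_of_ne, Function.update_self]
  simp only [hL, Bool.and_false, Bool.and_true, Bool.false_eq_true, if_false]
  rw [← factorOut_eq]
  ring

theorem run_fourier_flatMap
    (E : (Fin m → Bool) → Bool → (Fin r → Bool) → Bool → Bool → (Fin a → Bool) → ℂ)
    (x : Dom ω) (L : List (Fin ω)) (hL : L.Nodup) :
    run (L.flatMap fourierBody) (digitState E fun j => factorIn (x j))
      = (digitState E fun j => if j ∈ L then factorOut (x j) else factorIn (x j) :
          State (Wire m ω r a)) := by
  induction L using List.reverseRecOn with
  | nil => simp [run_nil]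
  | append_singleton L i ih =>
    rw [List.nodup_append] at hL
    have hi : i ∉ L := fun h => hL.2.2 i h i (by simp) rfl
    rw [List.flatMap_append, run_append, ih hL.1, List.flatMap_singleton,
      run_fourierBody E _ i (x i) (by simp [hi])]
    congr 1
    funext j
    by_cases h : j = i
    · subst h; simp
    · simp [h]

/-- The factor of the wires outside of the domain and the equation registers. -/
noncomputable def outerFactor (k : Bits m) (b : Bool) (y : Bits r) (k' : Fin m → Bool) (b' : Bool)
    (y' : Fin r → Bool) (w v : Bool) (anc : Fin a → Bool) : ℂ :=
  if k' = k ∧ b' = b ∧ y' = y ∧ w = false ∧ v = false ∧ anc = fun _ => false then 1 else 0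

theorem basis_assignment (k : Bits m) (b : Bool) (x : Dom ω) (y : Bits r) :
    basis (assignment k b x y : Wire m ω r a → Bool)
      = digitState (outerFactor k b y) fun j => factorIn (x j) := by
  funext s
  by_cases h : s = assignment k b x y
  · subst h
    simp [basis, digitState, outerFactor, factorIn, assignment]
  · rw [basis, if_neg h]
    symm
    by_contra hne
    rw [digitState, mul_eq_zero, not_or, ← ne_eq, ← ne_eq, Finset.prod_ne_zero_iff] at hne
    obtain ⟨h1, h2⟩ := hne
    simp only [outerFactor, ne_eq, ite_eq_right_iff, one_ne_zero, imp_false, not_not] at h1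
    simp only [factorIn, ne_eq, ite_eq_right_iff, one_ne_zero, imp_false, not_not,
      Finset.mem_univ, forall_true_left] at h2
    obtain ⟨hk, hb, hy, hw, hv, ha⟩ := h1
    refine h (funext fun i => ?_)
    cases i with
    | key i => exact congrFun hk i
    | b => exact hb
    | xlo j => exact (h2 j).1
    | xhi j => exact (h2 j).2.1
    | y i => exact congrFun hy i
    | dlo j => exact (h2 j).2.2.1
    | dhi j => exact (h2 j).2.2.2
    | w => exact hw
    | v => exact hv
    | anc i => exact congrFun ha i

/-- The bit assignment after the equation `d` was returned. -/
def postAssignment (k : Bits m) (b : Bool) (y : Bits r) (d : Fin ω → ZMod 4) :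
    Wire m ω r a → Bool
  | .key i => k i
  | .b => b
  | .xlo j => bitV (d j)
  | .xhi j => bitW (d j)
  | .y i => y i
  | .dlo j => bitW (d j)
  | .dhi j => bitV (d j)
  | _ => false

/-- The measurement of a domain element `x` in the Fourier basis: each outcome `d` has the amplitude
`2^(-ω) i^(d·x)`. -/
theorem project_run_equationCircuit (k : Bits m) (b : Bool) (x : Dom ω) (y : Bits r)
    (d : Fin ω → ZMod 4) :
    project (fun s => readD s = d) (run equationCircuit (basis (assignment k b x y)))
      = ((1 / 2) ^ ω * iPow (d ⬝ᵥ vec x)) •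
        basis (postAssignment k b y d : Wire m ω r a → Bool) := by
  rw [basis_assignment, equationCircuit, digitLoop,
    run_fourier_flatMap _ _ _ (List.nodup_finRange ω)]
  simp only [List.mem_finRange, if_true]
  funext s
  by_cases h : s = postAssignment k b y d
  · subst h
    have hd : readD (postAssignment k b y d : Wire m ω r a → Bool) = d := by
      funext j
      exact digit_bits (d j)
    simp only [project, hd, if_true, Pi.smul_apply, basis, smul_eq_mul, mul_one, digitState]
    simp [outerFactor, factorOut, postAssignment, digit_bits, Finset.prod_mul_distrib, vec,
      dotProduct, iPow_sum]
  · simp only [Pi.smul_apply, basis, if_neg h, smul_zero]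
    by_contra hne
    simp only [project, ite_eq_right_iff, Classical.not_imp] at hne
    obtain ⟨hd, hne⟩ := hne
    rw [digitState, mul_eq_zero, not_or, ← ne_eq, ← ne_eq, Finset.prod_ne_zero_iff] at hne
    obtain ⟨h1, h2⟩ := hne
    simp only [outerFactor, ne_eq, ite_eq_right_iff, one_ne_zero, imp_false, not_not] at h1
    have h3 : ∀ j, s (.dlo j) = s (.xhi j) ∧ s (.dhi j) = s (.xlo j) := by
      intro j
      by_contra hj
      exact h2 j (Finset.mem_univ j) (by rw [factorOut, if_neg hj])
    obtain ⟨hk, hb, hy, hw, hv, ha⟩ := h1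
    have h4 : ∀ j, s (.dlo j) = bitW (d j) ∧ s (.dhi j) = bitV (d j) := by
      intro j
      rw [← hd]
      exact ⟨(bits_digit _ _).1.symm, (bits_digit _ _).2.symm⟩
    refine h (funext fun i => ?_)
    cases i with
    | key i => exact congrFun hk i
    | b => exact hb
    | xlo j => exact (h3 j).2.symm.trans (h4 j).2
    | xhi j => exact (h3 j).1.symm.trans (h4 j).1
    | y i => exact congrFun hy i
    | dlo j => exact (h4 j).1
    | dhi j => exact (h4 j).2
    | w => exact hw
    | v => exact hv
    | anc i => exact congrFun ha i

end Fourier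

/-! ### The states of the honest prover -/

section Superposition

variable {m ω r a : ℕ}

/-- The wires that carry `(b, x)`. -/
def preimageWires : List (Wire m ω r a) :=
  (List.finRange ω).flatMap (fun j => [.xlo j, .xhi j]) ++ [.b]

theorem nodup_flatMap_pair {f g : Fin ω → Wire m ω r a} (hf : Function.Injective f)
    (hg : Function.Injective g) (hfg : ∀ i j, f i ≠ g j) :
    ((List.finRange ω).flatMap fun j => [f j, g j]).Nodup := by
  rw [List.nodup_flatMap]
  refine ⟨fun j _ => by simp [hfg], (List.nodup_finRange ω).imp ?_⟩
  intro i j hij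
  simp [Function.onFun, List.disjoint_left, hf.ne hij, hg.ne hij, hfg, (hfg _ _).symm]

theorem nodup_preimageWires : (preimageWires : List (Wire m ω r a)).Nodup := by
  rw [preimageWires, List.nodup_append]
  refine ⟨nodup_flatMap_pair (fun i j h => by simpa using h) (fun i j h => by simpa using h)
    (by simp), by simp, ?_⟩
  rintro i hi j hj rfl
  simp_all

theorem length_preimageWires :
    (preimageWires : List (Wire m ω r a)).length = 2 * ω + 1 := by
  simp [preimageWires, mul_comm]

/-- The amplitude of each `(b, x)` in the uniform superposition. -/
noncomputable def amplitude (n : ℕ) : ℂ := (1 / (Real.sqrt 2 : ℂ)) ^ n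

theorem norm_amplitude_sq (n : ℕ) : ‖amplitude n‖ ^ 2 = (1 / 2) ^ n := by
  have h2 : ‖(1 / (Real.sqrt 2 : ℂ))‖ ^ 2 = 1 / 2 := by
    rw [norm_div, norm_one, Complex.norm_real, Real.norm_of_nonneg (Real.sqrt_nonneg 2), div_pow,
      Real.sq_sqrt zero_le_two, one_pow]
  rw [amplitude, norm_pow, pow_right_comm, h2]

theorem run_superpose (k : Bits m) :
    run (preimageWires.map Gate.H) (start k : State (Wire m ω r a))
      = ∑ b, ∑ x, amplitude (2 * ω + 1) • basis (assignment k b x fun _ => false) := by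
  funext s
  rw [start, run_hadamards _ _ nodup_preimageWires, length_preimageWires]
  · simp only [Finset.sum_apply, Pi.smul_apply, smul_eq_mul, basis]
    split_ifs with h
    · have hs : s = assignment k (s .b) (readX s) fun _ => false := by
        funext i
        cases i with
        | xlo j => rfl
        | xhi j => rfl
        | b => rfl
        | key i => exact h (.key i) (by simp [preimageWires])
        | y i => exact h (.y i) (by simp [preimageWires])
        | dlo i => exact h (.dlo i) (by simp [preimageWires])
        | dhi i => exact h (.dhi i) (by simp [preimageWires])
        | w => exact h .w (by simp [preimageWires])
        | v => exact h .v (by simp [preimageWires])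
        | anc i => exact h (.anc i) (by simp [preimageWires])
      rw [Fintype.sum_eq_single (s .b), Fintype.sum_eq_single (readX s), if_pos hs, mul_one]
      · rfl
      · intro x hx
        rw [if_neg, mul_zero]
        intro e
        exact hx (by rw [e]; rfl)
      · intro b hb
        refine Finset.sum_eq_zero fun x _ => ?_
        rw [if_neg, mul_zero]
        intro e
        exact hb (by rw [e]; rfl)
    · symm
      refine Finset.sum_eq_zero fun b _ => Finset.sum_eq_zero fun x _ => ?_
      rw [if_neg, mul_zero]
      rintro rfl
      refine h fun i hi => ?_
      cases i with
      | xlo j => simp [preimageWires] at hi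
      | xhi j => simp [preimageWires] at hi
      | b => simp [preimageWires] at hi
      | _ => rfl
  · intro i hi
    cases i <;> first | rfl | simp [preimageWires] at hi

theorem commitCircuit_eq (C : Circuit m ω r a) :
    commitCircuit C = preimageWires.map Gate.H ++ C := by
  simp [commitCircuit, preimageWires, digitLoop, List.map_flatMap]

theorem project_basis (p : (Wire m ω r a → Bool) → Prop) (s : Wire m ω r a → Bool)
    [Decidable (p s)] : project p (basis s) = if p s then basis s else 0 := by
  funext s'
  by_cases h : s' = s
  · subst h
    by_cases hp : p s' <;> simp [project, hp]
  · by_cases hp : p s <;> simp [project, basis, h, hp]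

end Superposition

section States

variable (F : TrapdoorFamilies) (ℓ : ℕ)

/-- The keys for which the evaluation circuit is correct. -/
def Evaluates (k : Bits (F.m ℓ)) : Prop :=
  ∀ b x, run (F.eval ℓ) (basis (assignment k b x (fun _ => false)))
    = basis (assignment k b x (F.h ℓ k b x))

variable {F ℓ}

theorem stateY_honest {k : Bits (F.m ℓ)} (hk : Evaluates F ℓ k) (y : Bits (F.r ℓ)) :
    (honest F).stateY ℓ k y = ∑ b, ∑ x, (if F.h ℓ k b x = y then amplitude (2 * F.ω ℓ + 1) else 0) •
      basis (assignment k b x y) := by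
  have h1 : run ((honest F).commit ℓ) (start k) = ∑ b, ∑ x, amplitude (2 * F.ω ℓ + 1) •
      basis (assignment k b x (F.h ℓ k b x)) := by
    change run (commitCircuit (F.eval ℓ)) (start k) = _
    rw [commitCircuit_eq, run_append, run_superpose]
    change runLin (F.eval ℓ) _ = _
    simp only [map_sum, map_smul]
    exact Finset.sum_congr rfl fun b _ => Finset.sum_congr rfl fun x _ =>
      congrArg _ (hk b x)
  rw [Prover.stateY, h1]
  change projectLin (fun s => readY s = y) _ = _
  simp only [map_sum, map_smul]
  refine Finset.sum_congr rfl fun b _ => Finset.sum_congr rfl fun x _ => ?_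
  change _ • project (fun s => readY s = y) (basis _) = _
  have e : readY (assignment k b x (F.h ℓ k b x) : Wire (F.m ℓ) (F.ω ℓ) (F.r ℓ) (F.a ℓ) → Bool)
      = F.h ℓ k b x := rfl
  rw [project_basis, e]
  by_cases h : F.h ℓ k b x = y
  · rw [if_pos h, if_pos h, h]
  · rw [if_neg h, if_neg h, smul_zero, zero_smul]

/-- The amplitude of `|b⟩` in the state after the answers `y` and `d`. -/
noncomputable def branch (F : TrapdoorFamilies) (ℓ : ℕ) (k : Bits (F.m ℓ)) (y : Bits (F.r ℓ))
    (d : Fin (F.ω ℓ) → ZMod 4) (b : Bool) : ℂ :=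
  ∑ x, if F.h ℓ k b x = y then
    amplitude (2 * F.ω ℓ + 1) * ((1 / 2) ^ F.ω ℓ * iPow (d ⬝ᵥ vec x)) else 0

theorem stateD_honest {k : Bits (F.m ℓ)} (hk : Evaluates F ℓ k) (y : Bits (F.r ℓ))
    (d : Fin (F.ω ℓ) → ZMod 4) :
    (honest F).stateD ℓ k y d = ∑ b, branch F ℓ k y d b • basis (postAssignment k b y d) := by
  rw [Prover.stateD, stateY_honest hk]
  change projectLin (fun s => readD s = d) (runLin equationCircuit _) = _
  simp only [map_sum, map_smul, branch, Finset.sum_smul]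
  refine Finset.sum_congr rfl fun b _ => Finset.sum_congr rfl fun x _ => ?_
  have h := project_run_equationCircuit (a := F.a ℓ) k b x y d
  change _ • project (fun s => readD s = d) (run equationCircuit (basis _)) = _
  refine (congrArg _ h).trans ?_
  by_cases e : F.h ℓ k b x = y
  · rw [if_pos e, if_pos e, smul_smul]
  · rw [if_neg e, if_neg e, zero_smul, zero_smul]

theorem stateD_honest_apply {k : Bits (F.m ℓ)} (hk : Evaluates F ℓ k) (y : Bits (F.r ℓ))
    (d : Fin (F.ω ℓ) → ZMod 4) (s : Wire (F.m ℓ) (F.ω ℓ) (F.r ℓ) (F.a ℓ) → Bool) :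
    (honest F).stateD ℓ k y d s
      = if s = postAssignment k (s .b) y d then branch F ℓ k y d (s .b) else 0 := by
  rw [stateD_honest hk, Finset.sum_apply, Fintype.sum_eq_single (s .b)]
  · simp [basis]
  · intro b hb
    have : s ≠ postAssignment k b y d := fun e => hb (by rw [e]; rfl)
    simp [basis, this]

theorem weight_stateD_honest {k : Bits (F.m ℓ)} (hk : Evaluates F ℓ k) (y : Bits (F.r ℓ))
    (d : Fin (F.ω ℓ) → ZMod 4) :
    weight ((honest F).stateD ℓ k y d)
      = ‖branch F ℓ k y d false‖ ^ 2 + ‖branch F ℓ k y d true‖ ^ 2 := by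
  have hinj : Function.Injective fun b : Bool =>
      (postAssignment k b y d : Wire (F.m ℓ) (F.ω ℓ) (F.r ℓ) (F.a ℓ) → Bool) :=
    fun b b' h => congrFun h .b
  have h := Fintype.sum_of_injective _ hinj (fun b => ‖branch F ℓ k y d b‖ ^ 2)
    (fun s => ‖(honest F).stateD ℓ k y d s‖ ^ 2) (fun s hs => by
      rw [stateD_honest_apply hk, if_neg fun e => hs ⟨s .b, e.symm⟩]
      simp) (fun b => by
      rw [stateD_honest_apply hk]
      change _ = ‖if postAssignment k b y d = postAssignment k b y d then branch F ℓ k y d b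
        else 0‖ ^ 2
      rw [if_pos rfl])
  rw [Fintype.sum_bool, add_comm] at h
  exact h.symm

theorem branch_of_eq {k : Bits (F.m ℓ)} {b : Bool} (hk : Function.Injective (F.h ℓ k b))
    {x : Dom (F.ω ℓ)} {y : Bits (F.r ℓ)} (hx : F.h ℓ k b x = y) (d : Fin (F.ω ℓ) → ZMod 4) :
    branch F ℓ k y d b
      = amplitude (2 * F.ω ℓ + 1) * ((1 / 2) ^ F.ω ℓ * iPow (d ⬝ᵥ vec x)) := by
  rw [branch, Fintype.sum_eq_single x, if_pos hx]
  intro x' hx'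
  rw [if_neg]
  rintro rfl
  exact hx' (hk hx.symm)

theorem branch_of_ne {k : Bits (F.m ℓ)} {b : Bool} {y : Bits (F.r ℓ)}
    (hy : ∀ x, F.h ℓ k b x ≠ y) (d : Fin (F.ω ℓ) → ZMod 4) : branch F ℓ k y d b = 0 :=
  Finset.sum_eq_zero fun x _ => if_neg (hy x)

theorem norm_branch_sq {k : Bits (F.m ℓ)} {b : Bool} (hk : Function.Injective (F.h ℓ k b))
    (y : Bits (F.r ℓ)) (d : Fin (F.ω ℓ) → ZMod 4) :
    ‖branch F ℓ k y d b‖ ^ 2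
      = 1 / 2 * (1 / 4 ^ F.ω ℓ) ^ 2 * ∑ x, if F.h ℓ k b x = y then 1 else 0 := by
  by_cases h : ∃ x, F.h ℓ k b x = y
  · obtain ⟨x, hx⟩ := h
    rw [branch_of_eq hk hx, norm_mul, norm_mul, norm_iPow, mul_one, mul_pow, norm_amplitude_sq,
      Fintype.sum_eq_single x, if_pos hx]
    · rw [norm_pow, ← pow_mul, mul_comm (F.ω ℓ) 2, pow_mul ‖(1 / 2 : ℂ)‖, pow_succ, pow_mul]
      norm_num
      simp only [one_div, inv_pow, sq, mul_inv]
      ring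
    · intro x' hx'
      rw [if_neg]
      rintro rfl
      exact hx' (hk hx.symm)
  · push Not at h
    rw [branch_of_ne h, Finset.sum_eq_zero fun x _ => if_neg (h x)]
    simp

end States

/-! ### The honest prover wins -/

theorem ind_mul_weight {S : Type} [Fintype S] [DecidableEq S] {p : Prop} {ψ : State S}
    (h : ψ ≠ 0 → p) : ind p * weight ψ = weight ψ := by
  by_cases hψ : ψ = 0
  · rw [weight_eq_zero.2 hψ, mul_zero]
  · rw [ind, if_pos (h hψ), one_mul]

section Win

variable {F : TrapdoorFamilies}

/-- A prover whose possible answers all pass the tests wins with certainty. -/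
theorem winProbGiven_eq_one (P : Prover F) (ℓ : ℕ) (G : Bool) (kt : Bits (F.m ℓ) × Bits (F.t ℓ))
    (hBX : ∀ y b x, P.stateBX ℓ kt.1 y b x ≠ 0 →
      ∃ p, invert F ℓ G kt y = some p ∧ PreimageTest p b x)
    (hV : ∀ y d c v, P.stateV ℓ kt.1 y d c v ≠ 0 →
      ∃ p, invert F ℓ G kt y = some p ∧ ConsistencyCheck p d c v)
    (hD : ∀ y d, P.stateD ℓ kt.1 y d ≠ 0 → ∃ p, invert F ℓ G kt y = some p) :
    P.winProbGiven ℓ G kt = 1 := by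
  have e1 : ∀ y, ∑ b, ∑ x, weight (P.stateBX ℓ kt.1 y b x) = weight (P.stateY ℓ kt.1 y) := by
    intro y
    rw [← weight_run (P.preimage ℓ) (P.stateY ℓ kt.1 y),
      ← sum_weight_project (fun s => (s .b, readX s)), Fintype.sum_prod_type]
    simp only [Prod.mk.injEq]
    rfl
  have e2 : ∀ y, ∑ d, weight (P.stateD ℓ kt.1 y d) = weight (P.stateY ℓ kt.1 y) := by
    intro y
    rw [← weight_run (P.equation ℓ) (P.stateY ℓ kt.1 y), ← sum_weight_project (fun s => readD s)]
    rfl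
  have e3 : ∀ y d c, ∑ v, weight (P.stateV ℓ kt.1 y d c v) = weight (P.stateD ℓ kt.1 y d) := by
    intro y d c
    rw [← weight_run (P.answer c ℓ) (P.stateD ℓ kt.1 y d), ← sum_weight_project (fun s => s .v)]
    rfl
  have e4 : ∑ y, weight (P.stateY ℓ kt.1 y) = 1 := by
    rw [← weight_basis (assignment kt.1 false (fun _ => (false, false)) fun _ => false),
      ← weight_run (P.commit ℓ), ← sum_weight_project (fun s => readY s)]
    rfl
  have e5 : (Fintype.card Basis : ℝ) = 5 := by norm_num [show Fintype.card Basis = 5 from rfl]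
  rw [Prover.winProbGiven]
  refine Eq.trans ?_ e4
  refine Finset.sum_congr rfl fun y _ => ?_
  simp only [fun b x => ind_mul_weight (hBX y b x), fun d c v => ind_mul_weight (hV y d c v),
    fun d => ind_mul_weight (hD y d), e1, e3, Finset.sum_const, Finset.card_univ, nsmul_eq_mul, e5]
  have e6 : ∀ d, (1 / 2 : ℝ) * (5 * (1 / 5 * weight (P.stateD ℓ kt.1 y d)))
      + 1 / 2 * weight (P.stateD ℓ kt.1 y d) = weight (P.stateD ℓ kt.1 y d) := fun d => by ring
  simp only [e6, e2]
  ring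

theorem invert_two {ℓ : ℕ} {kt : Bits (F.m ℓ) × Bits (F.t ℓ)} (hkt : kt ∈ (F.genF ℓ).support)
    {y : Bits (F.r ℓ)} {x₀ x₁ : Dom (F.ω ℓ)} :
    invert F ℓ false kt y = some (.two x₀ x₁) ↔
      F.h ℓ kt.1 false x₀ = y ∧ F.h ℓ kt.1 true x₁ = y := by
  simp [invert, ← F.invF_spec ℓ kt hkt, Option.bind_eq_some_iff]

theorem invert_one {ℓ : ℕ} {kt : Bits (F.m ℓ) × Bits (F.t ℓ)} (hkt : kt ∈ (F.genG ℓ).support)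
    {y : Bits (F.r ℓ)} {b : Bool} {x : Dom (F.ω ℓ)} :
    invert F ℓ true kt y = some (.one b x) ↔ F.h ℓ kt.1 b x = y := by
  simp [invert, ← F.invG_spec ℓ kt hkt]

theorem evaluates_of_mem_genF {ℓ : ℕ} {kt : Bits (F.m ℓ) × Bits (F.t ℓ)}
    (h : kt ∈ (F.genF ℓ).support) : Evaluates F ℓ kt.1 := F.eval_spec ℓ kt (Or.inl h)

theorem evaluates_of_mem_genG {ℓ : ℕ} {kt : Bits (F.m ℓ) × Bits (F.t ℓ)}
    (h : kt ∈ (F.genG ℓ).support) : Evaluates F ℓ kt.1 := F.eval_spec ℓ kt (Or.inr h)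

theorem exists_claw {ℓ : ℕ} {kt : Bits (F.m ℓ) × Bits (F.t ℓ)} (hkt : kt ∈ (F.genF ℓ).support)
    {b : Bool} {x : Dom (F.ω ℓ)} {y : Bits (F.r ℓ)} (h : F.h ℓ kt.1 b x = y) :
    ∃ x₀ x₁, F.h ℓ kt.1 false x₀ = y ∧ F.h ℓ kt.1 true x₁ = y ∧ x = if b then x₁ else x₀ := by
  have hr := F.range_F ℓ kt hkt
  cases b
  · obtain ⟨x₁, h₁⟩ : y ∈ Set.range (F.h ℓ kt.1 true) := hr ▸ ⟨x, h⟩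
    exact ⟨x, x₁, h, h₁, rfl⟩
  · obtain ⟨x₀, h₀⟩ : y ∈ Set.range (F.h ℓ kt.1 false) := hr ▸ ⟨x, h⟩
    exact ⟨x₀, x, h₀, h, rfl⟩

theorem exists_of_stateBX_ne_zero {ℓ : ℕ} {k : Bits (F.m ℓ)} (hk : Evaluates F ℓ k)
    {y : Bits (F.r ℓ)} {b : Bool} {x : Dom (F.ω ℓ)} (h : (honest F).stateBX ℓ k y b x ≠ 0) :
    F.h ℓ k b x = y := by
  by_contra hne
  refine h ?_
  rw [Prover.stateBX, run_nil, stateY_honest hk]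
  change projectLin (fun s => s .b = b ∧ readX s = x) _ = _
  simp only [map_sum, map_smul]
  refine Finset.sum_eq_zero fun b' _ => Finset.sum_eq_zero fun x' _ => ?_
  split_ifs with h'
  · change _ • project _ (basis _) = _
    classical
    rw [project_basis, if_neg, smul_zero]
    rintro ⟨rfl, rfl⟩
    exact hne h'
  · exact zero_smul _ _

theorem exists_of_branch_ne_zero {ℓ : ℕ} {k : Bits (F.m ℓ)} {y : Bits (F.r ℓ)}
    {d : Fin (F.ω ℓ) → ZMod 4} {b : Bool} (h : branch F ℓ k y d b ≠ 0) :
    ∃ x, F.h ℓ k b x = y := by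
  by_contra hne
  push Not at hne
  exact h (branch_of_ne hne d)

theorem exists_of_stateD_ne_zero {ℓ : ℕ} {k : Bits (F.m ℓ)} (hk : Evaluates F ℓ k)
    {y : Bits (F.r ℓ)} {d : Fin (F.ω ℓ) → ZMod 4} (h : (honest F).stateD ℓ k y d ≠ 0) :
    ∃ b x, F.h ℓ k b x = y := by
  by_contra hne
  push Not at hne
  refine h ?_
  rw [stateD_honest hk]
  refine Finset.sum_eq_zero fun b _ => ?_
  rw [branch_of_ne (hne b), zero_smul]

/-- The amplitudes of the two branches for a claw differ by the phase `i^(d·(x₁ - x₀))`. -/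
theorem branch_true_eq {ℓ : ℕ} {kt : Bits (F.m ℓ) × Bits (F.t ℓ)} (hkt : kt ∈ (F.genF ℓ).support)
    {y : Bits (F.r ℓ)} {x₀ x₁ : Dom (F.ω ℓ)} (h₀ : F.h ℓ kt.1 false x₀ = y)
    (h₁ : F.h ℓ kt.1 true x₁ = y) (d : Fin (F.ω ℓ) → ZMod 4) :
    branch F ℓ kt.1 y d true = branch F ℓ kt.1 y d false * iPow (angle d x₀ x₁) := by
  have e : d ⬝ᵥ vec x₁ = d ⬝ᵥ vec x₀ + angle d x₀ x₁ := by
    rw [angle, dotProduct_sub]; ring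
  rw [branch_of_eq (F.injective_F ℓ kt hkt true) h₁, branch_of_eq (F.injective_F ℓ kt hkt false) h₀,
    e, iPow_add]
  ring

/-- The phase of the gate `T`. -/
noncomputable def phaseT : ℂ := Complex.exp (Real.pi / 4 * Complex.I)

theorem phaseT_sq : phaseT ^ 2 = Complex.I := by
  rw [phaseT, ← Complex.exp_nat_mul,
    show ((2 : ℕ) : ℂ) * (Real.pi / 4 * Complex.I) = Real.pi / 2 * Complex.I by push_cast; ring]
  exact Complex.exp_pi_div_two_mul_I

theorem phaseT_pow_six : phaseT ^ 6 = -Complex.I := by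
  rw [show 6 = 2 * 3 from rfl, pow_mul, phaseT_sq, Complex.I_pow_three]

section Answer

variable {m ω r a : ℕ}

theorem run_replicate_T (n : ℕ) (ψ : State (Wire m ω r a)) (s : Wire m ω r a → Bool) :
    run (List.replicate n (.T .b)) ψ s = (if s .b then phaseT ^ n else 1) * ψ s := by
  induction n generalizing ψ with
  | zero => simp [run_nil]
  | succ n ih =>
    rw [List.replicate_succ, run_cons, ih]
    change _ * ((if s .b then phaseT else 1) * ψ s) = _
    split_ifs <;> ring

theorem run_answerCircuit {c : Basis} (hc : c ≠ .Z) (ψ : State (Wire m ω r a))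
    (s : Wire m ω r a → Bool) :
    run (answerCircuit c) ψ s = 1 / (Real.sqrt 2 : ℂ) *
      (ψ (Function.update (Function.update s .v (xor (s .v) (s .b))) .b false) +
        (if s .b then -1 else 1) * (phaseT ^ rotation c *
          ψ (Function.update (Function.update s .v (xor (s .v) (s .b))) .b true))) := by
  rw [answerCircuit, if_neg hc, run_append]
  simp only [List.singleton_append, run_cons, run_nil, Gate.apply, run_replicate_T]
  simp

theorem run_answerCircuit_Z (ψ : State (Wire m ω r a)) (s : Wire m ω r a → Bool) :
    run (answerCircuit .Z) ψ s = ψ (Function.update s .v (xor (s .v) (s .b))) := by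
  rw [answerCircuit, if_pos rfl]
  rfl

theorem update_eq_postAssignment (s : Wire m ω r a → Bool) (k : Bits m) (β : Bool) (y : Bits r)
    (d : Fin ω → ZMod 4) :
    Function.update s .b β = postAssignment k β y d ↔
      Function.update s .b false = postAssignment k false y d := by
  constructor <;> intro h <;> funext i <;> by_cases hi : i = .b
  · subst hi; simp [postAssignment]
  · have := congrFun h i
    rw [Function.update_of_ne hi] at this ⊢
    rw [this]
    cases i <;> first | rfl | exact absurd rfl hi
  · subst hi; simp [postAssignment]
  · have := congrFun h i
    rw [Function.update_of_ne hi] at this ⊢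
    rw [this]
    cases i <;> first | rfl | exact absurd rfl hi

end Answer

/-- In the bases `X` and `Y` the outcome that is orthogonal to the prepared qubit does not occur. -/
theorem eq_bitV_of_ne_zero {c : Basis} {t : ZMod 4}
    (hc : (c = .X ∧ bitW t = false) ∨ (c = .Y ∧ bitW t = true)) {β : Bool}
    (h : 1 + (if β then -1 else 1) * (phaseT ^ rotation c * iPow t) ≠ 0) : β = bitV t := by
  have h2 : iPow 2 = -1 := by simp [iPow, show (2 : ZMod 4).val = 2 from rfl]
  have h1 : iPow 1 = Complex.I := by simp [iPow, show (1 : ZMod 4).val = 1 from rfl]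
  have h3 : iPow 3 = -Complex.I := by
    rw [show (3 : ZMod 4) = 2 + 1 from rfl, iPow_add, h1, h2]; ring
  rcases hc with ⟨rfl, hc⟩ | ⟨rfl, hc⟩
  · have ht : ∀ t, bitW t = false → t = 0 ∨ t = 2 := by decide
    rcases ht t hc with rfl | rfl <;> cases β <;>
      simp_all [rotation, iPow_zero, show bitV 0 = false from rfl, show bitV 2 = true from rfl]
  · have ht : ∀ t, bitW t = true → t = 1 ∨ t = 3 := by decide
    rcases ht t hc with rfl | rfl <;> cases β <;>
      simp_all [rotation, phaseT_pow_six, show bitV 1 = false from rfl,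
        show bitV 3 = true from rfl]

theorem exists_ne_zero_of_project {W : Type} {p : (W → Bool) → Prop} {ψ : State W}
    (h : project p ψ ≠ 0) : ∃ s, p s ∧ ψ s ≠ 0 := by
  by_contra hne
  push Not at hne
  refine h (funext fun s => ?_)
  by_cases hp : p s
  · simp [project, hp, hne s hp]
  · simp [project, hp]

theorem consistencyCheck_two {ℓ : ℕ} {kt : Bits (F.m ℓ) × Bits (F.t ℓ)}
    (hkt : kt ∈ (F.genF ℓ).support) {y : Bits (F.r ℓ)} {x₀ x₁ : Dom (F.ω ℓ)}
    (h₀ : F.h ℓ kt.1 false x₀ = y) (h₁ : F.h ℓ kt.1 true x₁ = y) {d : Fin (F.ω ℓ) → ZMod 4}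
    {c : Basis} {v : Bool} (hne : (honest F).stateV ℓ kt.1 y d c v ≠ 0) :
    ConsistencyCheck (.two x₀ x₁) d c v := by
  intro hc
  have hcZ : c ≠ .Z := by rcases hc with ⟨rfl, _⟩ | ⟨rfl, _⟩ <;> simp
  obtain ⟨s, hv, hs⟩ := exists_ne_zero_of_project hne
  have hk := evaluates_of_mem_genF hkt
  change run (answerCircuit c) _ s ≠ 0 at hs
  rw [run_answerCircuit hcZ, stateD_honest_apply hk, stateD_honest_apply hk] at hs
  simp only [Function.update_self] at hs
  rw [branch_true_eq hkt h₀ h₁] at hs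
  simp only [update_eq_postAssignment _ _ true] at hs
  by_cases hp : Function.update (Function.update s .v (xor (s .v) (s .b))) .b false
      = postAssignment kt.1 false y d
  · simp only [if_pos hp] at hs
    have hb : s .v = s .b := by
      have := congrFun hp .v
      simpa [postAssignment] using this
    rw [← hv, hb]
    refine eq_bitV_of_ne_zero hc fun e => hs ?_
    linear_combination (1 / (Real.sqrt 2 : ℂ) * branch F ℓ kt.1 y d false) * e
  · simp only [if_neg hp] at hs
    simp at hs

theorem consistencyCheck_one {ℓ : ℕ} {kt : Bits (F.m ℓ) × Bits (F.t ℓ)}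
    (hkt : kt ∈ (F.genG ℓ).support) {y : Bits (F.r ℓ)} {b : Bool} {x : Dom (F.ω ℓ)}
    (h : F.h ℓ kt.1 b x = y) {d : Fin (F.ω ℓ) → ZMod 4}
    {c : Basis} {v : Bool} (hne : (honest F).stateV ℓ kt.1 y d c v ≠ 0) :
    ConsistencyCheck (.one b x) d c v := by
  rintro rfl
  obtain ⟨s, hv, hs⟩ := exists_ne_zero_of_project hne
  have hk := evaluates_of_mem_genG hkt
  change run (answerCircuit .Z) _ s ≠ 0 at hs
  rw [run_answerCircuit_Z, stateD_honest_apply hk] at hs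
  simp only [ne_eq, ite_eq_right_iff, Classical.not_imp] at hs
  obtain ⟨hp, hs⟩ := hs
  have hb : s .v = s .b := by
    have := congrFun hp .v
    simpa [postAssignment] using this
  obtain ⟨x', hx'⟩ := exists_of_branch_ne_zero hs
  have := F.injective_G ℓ kt hkt (a₁ := (b, x)) (a₂ := (s .b, x')) (by
    simp only
    rw [h, ← hx']
    simp)
  rw [← hv, hb]
  exact (congrArg Prod.fst this).symm

theorem winProbGiven_honest_false {ℓ : ℕ} {kt : Bits (F.m ℓ) × Bits (F.t ℓ)}
    (hkt : kt ∈ (F.genF ℓ).support) : (honest F).winProbGiven ℓ false kt = 1 := by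
  have hk := evaluates_of_mem_genF hkt
  have hD : ∀ y d, (honest F).stateD ℓ kt.1 y d ≠ 0 →
      ∃ x₀ x₁, F.h ℓ kt.1 false x₀ = y ∧ F.h ℓ kt.1 true x₁ = y := by
    intro y d h
    obtain ⟨b, x, hx⟩ := exists_of_stateD_ne_zero hk h
    obtain ⟨x₀, x₁, h₀, h₁, _⟩ := exists_claw hkt hx
    exact ⟨x₀, x₁, h₀, h₁⟩
  refine winProbGiven_eq_one _ _ _ _ ?_ ?_ ?_
  · intro y b x h
    obtain ⟨x₀, x₁, h₀, h₁, hx⟩ := exists_claw hkt (exists_of_stateBX_ne_zero hk h)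
    exact ⟨_, (invert_two hkt).2 ⟨h₀, h₁⟩, hx⟩
  · intro y d c v h
    obtain ⟨x₀, x₁, h₀, h₁⟩ := hD y d (by
      intro e
      refine h ?_
      rw [Prover.stateV, e]
      change projectLin _ (runLin _ 0) = 0
      rw [map_zero, map_zero])
    exact ⟨_, (invert_two hkt).2 ⟨h₀, h₁⟩, consistencyCheck_two hkt h₀ h₁ h⟩
  · intro y d h
    obtain ⟨x₀, x₁, h₀, h₁⟩ := hD y d h
    exact ⟨_, (invert_two hkt).2 ⟨h₀, h₁⟩⟩

theorem winProbGiven_honest_true {ℓ : ℕ} {kt : Bits (F.m ℓ) × Bits (F.t ℓ)}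
    (hkt : kt ∈ (F.genG ℓ).support) : (honest F).winProbGiven ℓ true kt = 1 := by
  have hk := evaluates_of_mem_genG hkt
  refine winProbGiven_eq_one _ _ _ _ ?_ ?_ ?_
  · intro y b x h
    exact ⟨_, (invert_one hkt).2 (exists_of_stateBX_ne_zero hk h), rfl, rfl⟩
  · intro y d c v h
    obtain ⟨b, x, hx⟩ := exists_of_stateD_ne_zero hk (y := y) (d := d) (by
      intro e
      refine h ?_
      rw [Prover.stateV, e]
      change projectLin _ (runLin _ 0) = 0
      rw [map_zero, map_zero])
    exact ⟨_, (invert_one hkt).2 hx, consistencyCheck_one hkt hx h⟩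
  · intro y d h
    obtain ⟨b, x, hx⟩ := exists_of_stateD_ne_zero hk h
    exact ⟨_, (invert_one hkt).2 hx⟩

theorem sum_toReal_pmf {α : Type} [Fintype α] (p : PMF α) : ∑ a, (p a).toReal = 1 := by
  have h : ∑ a, p a = 1 := by rw [← tsum_fintype (L := .unconditional α)]; exact p.tsum_coe
  rw [← ENNReal.toReal_sum (fun a _ => p.apply_ne_top a), h, ENNReal.toReal_one]

theorem sum_pmf_congr {α : Type} [Fintype α] (p : PMF α) {f g : α → ℝ}
    (h : ∀ a ∈ p.support, f a = g a) :
    ∑ a, (p a).toReal * f a = ∑ a, (p a).toReal * g a := by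
  refine Finset.sum_congr rfl fun a _ => ?_
  by_cases ha : p a = 0
  · simp [ha]
  · rw [h a ((p.mem_support_iff a).2 ha)]

theorem winProb_honest (ℓ : ℕ) : (honest F).winProb ℓ = 1 := by
  have h0 : ∑ kt, (gen F ℓ false kt).toReal * (honest F).winProbGiven ℓ false kt = 1 := by
    rw [← sum_toReal_pmf (gen F ℓ false), sum_pmf_congr (gen F ℓ false) (g := fun _ => 1)
      (fun kt hkt => winProbGiven_honest_false hkt)]
    simp
  have h1 : ∑ kt, (gen F ℓ true kt).toReal * (honest F).winProbGiven ℓ true kt = 1 := by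
    rw [← sum_toReal_pmf (gen F ℓ true), sum_pmf_congr (gen F ℓ true) (g := fun _ => 1)
      (fun kt hkt => winProbGiven_honest_true hkt)]
    simp
  rw [Prover.winProb, Fintype.sum_bool, h0, h1]
  norm_num

end Win

/-! ### The prepared qubit -/

section Qubit

variable {F : TrapdoorFamilies} {ℓ : ℕ}

/-- If the amplitudes of the two branches are proportional to those of a normalised qubit, then the
device holds that qubit. -/
theorem holdsQubit_of_branch {k : Bits (F.m ℓ)} (hk : Evaluates F ℓ k) {y : Bits (F.r ℓ)}
    {d : Fin (F.ω ℓ) → ZMod 4} {q : Bool → ℂ} (hq : ‖q false‖ ^ 2 + ‖q true‖ ^ 2 = 1) {α : ℂ}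
    (hα : α ≠ 0) (h : ∀ b, branch F ℓ k y d b = α * q b) :
    HoldsQubit (normalize ((honest F).stateD ℓ k y d)) q := by
  have hw : weight ((honest F).stateD ℓ k y d) = ‖α‖ ^ 2 := by
    rw [weight_stateD_honest hk, h, h, norm_mul, norm_mul, mul_pow, mul_pow, ← mul_add, hq, mul_one]
  have hα' : ‖α‖ ≠ 0 := norm_ne_zero_iff.2 hα
  let rest : {i : Wire (F.m ℓ) (F.ω ℓ) (F.r ℓ) (F.a ℓ) // i ≠ .b} → Bool :=
    fun i => (postAssignment k false y d : Wire (F.m ℓ) (F.ω ℓ) (F.r ℓ) (F.a ℓ) → Bool) i.1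
  refine ⟨fun s => if s = rest then α / ‖α‖ else 0, ?_, fun s => ?_⟩
  · rw [weight, Fintype.sum_eq_single rest]
    · rw [if_pos rfl, norm_div, Complex.norm_real, norm_norm, div_self hα', one_pow]
    · intro s hs
      rw [if_neg hs]
      simp
  · rw [normalize, hw, Real.sqrt_sq (norm_nonneg α), stateD_honest_apply hk]
    have e : s = postAssignment k (s .b) y d ↔ (fun i : {i // i ≠ Wire.b} => s i) = rest := by
      constructor
      · intro hs
        funext ⟨i, hi⟩
        change s i = postAssignment k false y d i
        rw [hs]
        cases i <;> first | rfl | exact absurd rfl hi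
      · intro hs
        funext i
        by_cases hi : i = .b
        · subst hi; rfl
        · refine (congrFun hs ⟨i, hi⟩).trans ?_
          change postAssignment k false y d i = _
          cases i <;> first | rfl | exact absurd rfl hi
    simp only [e]
    split_ifs
    · rw [h]; ring
    · simp

theorem exp_angle (t : ZMod 4) :
    Complex.exp (((Real.pi / 2 * t.val : ℝ) : ℂ) * Complex.I) = iPow t := by
  have h : Complex.exp (((Real.pi / 2 * t.val : ℝ) : ℂ) * Complex.I)
      = Complex.exp (Real.pi / 2 * Complex.I) ^ t.val := by
    rw [← Complex.exp_nat_mul]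
    congr 1
    push_cast
    ring
  rw [h, Complex.exp_pi_div_two_mul_I, iPow]

theorem holdsQubit_ket {kt : Bits (F.m ℓ) × Bits (F.t ℓ)} (hkt : kt ∈ (F.genG ℓ).support)
    (y : Bits (F.r ℓ)) (d : Fin (F.ω ℓ) → ZMod 4) (hne : (honest F).stateD ℓ kt.1 y d ≠ 0) :
    ∃ b x, F.h ℓ kt.1 b x = y ∧
      HoldsQubit (normalize ((honest F).stateD ℓ kt.1 y d)) (ket b) := by
  have hk := evaluates_of_mem_genG hkt
  obtain ⟨b, x, hx⟩ := exists_of_stateD_ne_zero hk hne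
  have hinj : Function.Injective (F.h ℓ kt.1 b) := fun x x' h =>
    congrArg Prod.snd (F.injective_G ℓ kt hkt (a₁ := (b, x)) (a₂ := (b, x')) h)
  have hz : branch F ℓ kt.1 y d (!b) = 0 := branch_of_ne (fun x' hx' => by
    have := congrArg Prod.fst (F.injective_G ℓ kt hkt (a₁ := (b, x)) (a₂ := (!b, x'))
      (hx.trans hx'.symm))
    simp at this) d
  refine ⟨b, x, hx, holdsQubit_of_branch hk (α := branch F ℓ kt.1 y d b) ?_ ?_ ?_⟩
  · cases b <;> simp [ket]
  · rw [branch_of_eq hinj hx]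
    simp [amplitude, iPow_ne_zero]
  · intro b'
    by_cases hb : b' = b
    · subst hb; simp [ket]
    · obtain rfl : b' = !b := by cases b <;> cases b' <;> simp_all
      simp [ket, hz]

theorem holdsQubit_ketPlus {kt : Bits (F.m ℓ) × Bits (F.t ℓ)} (hkt : kt ∈ (F.genF ℓ).support)
    (y : Bits (F.r ℓ)) (d : Fin (F.ω ℓ) → ZMod 4) (hne : (honest F).stateD ℓ kt.1 y d ≠ 0) :
    ∃ x₀ x₁, F.h ℓ kt.1 false x₀ = y ∧ F.h ℓ kt.1 true x₁ = y ∧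
      HoldsQubit (normalize ((honest F).stateD ℓ kt.1 y d))
        (ketPlus (Real.pi / 2 * (angle d x₀ x₁).val)) := by
  have hk := evaluates_of_mem_genF hkt
  obtain ⟨b, x, hx⟩ := exists_of_stateD_ne_zero hk hne
  obtain ⟨x₀, x₁, h₀, h₁, -⟩ := exists_claw hkt hx
  have hs : (Real.sqrt 2 : ℂ) ≠ 0 := by simp
  refine ⟨x₀, x₁, h₀, h₁, holdsQubit_of_branch hk
    (α := Real.sqrt 2 * branch F ℓ kt.1 y d false) ?_ ?_ ?_⟩
  · have h2 : ‖(1 / (Real.sqrt 2 : ℂ))‖ ^ 2 = 1 / 2 := by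
      simpa only [amplitude, pow_one] using norm_amplitude_sq 1
    simp only [ketPlus, exp_angle, norm_mul, mul_pow, h2, norm_iPow, if_true, Bool.false_eq_true,
      if_false, norm_one]
    norm_num
  · rw [branch_of_eq (F.injective_F ℓ kt hkt false) h₀]
    simp [amplitude, iPow_ne_zero]
  · intro b'
    simp only [ketPlus, exp_angle]
    cases b'
    · simp only [Bool.false_eq_true, if_false]
      field_simp
    · rw [branch_true_eq hkt h₀ h₁]
      simp only [if_true]
      field_simp

end Qubit

/-! ### The distributions of the bit and of the angle -/

theorem card_equations (ω : ℕ) : (Fintype.card (Fin ω → ZMod 4) : ℝ) = 4 ^ ω := by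
  simp [ZMod.card]

theorem card_dom (ω : ℕ) : (Fintype.card (Dom ω) : ℝ) = 4 ^ ω := by
  rw [Fintype.card_fun]
  norm_num [Fintype.card_fin]

theorem sum_fibers {α β : Type} [Fintype α] [Fintype β] [DecidableEq β] (f : α → β)
    (g : α → ℝ) : ∑ y, ∑ x, (if f x = y then g x else 0) = ∑ x, g x := by
  rw [Finset.sum_comm]
  exact Finset.sum_congr rfl fun x _ => by simp

section Distributions

variable {F : TrapdoorFamilies} {ℓ : ℕ}

/-- Given the key, each value of the bit has probability `1/2`. -/
theorem distB_given {kt : Bits (F.m ℓ) × Bits (F.t ℓ)} (hkt : kt ∈ (F.genG ℓ).support)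
    (β : Bool) : ∑ y, ∑ d, ind (∃ x, invert F ℓ true kt y = some (.one β x)) *
      weight ((honest F).stateD ℓ kt.1 y d) = 1 / 2 := by
  have hk := evaluates_of_mem_genG hkt
  have hinj : ∀ b, Function.Injective (F.h ℓ kt.1 b) := fun b x x' h =>
    congrArg Prod.snd (F.injective_G ℓ kt hkt (a₁ := (b, x)) (a₂ := (b, x')) h)
  have h1 : ∀ y d, ind (∃ x, invert F ℓ true kt y = some (.one β x)) *
      weight ((honest F).stateD ℓ kt.1 y d) = ‖branch F ℓ kt.1 y d β‖ ^ 2 := by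
    intro y d
    simp only [invert_one hkt]
    by_cases h : ∃ x, F.h ℓ kt.1 β x = y
    · obtain ⟨x, hx⟩ := h
      have hz : branch F ℓ kt.1 y d (!β) = 0 := branch_of_ne (fun x' hx' => by
        have := congrArg Prod.fst (F.injective_G ℓ kt hkt (a₁ := (β, x)) (a₂ := (!β, x'))
          (hx.trans hx'.symm))
        simp at this) d
      rw [ind, if_pos ⟨x, hx⟩, one_mul, weight_stateD_honest hk]
      cases β
      · rw [Bool.not_false] at hz
        simp [hz]
      · rw [Bool.not_true] at hz
        simp [hz]
    · rw [ind, if_neg h, zero_mul, branch_of_ne (fun x hx => h ⟨x, hx⟩)]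
      simp
  simp only [h1, norm_branch_sq (hinj β), Finset.sum_const, Finset.card_univ, nsmul_eq_mul,
    card_equations]
  rw [← Finset.mul_sum, ← Finset.mul_sum, sum_fibers (F.h ℓ kt.1 β) fun _ => 1, Finset.sum_const,
    Finset.card_univ, nsmul_eq_mul, card_dom]
  field_simp

theorem distToUniform_distB : distToUniform ((honest F).distB ℓ) = 0 := by
  have h : ∀ β, (honest F).distB ℓ β = 1 / 2 := by
    intro β
    rw [Prover.distB, sum_pmf_congr (F.genG ℓ) (g := fun _ => 1 / 2)
      (fun kt hkt => distB_given hkt β), ← Finset.sum_mul, sum_toReal_pmf, one_mul]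
  simp [distToUniform, h]

end Distributions

/-! ### Linear forms over `ℤ/4` -/

section LinearForms

variable {ω : ℕ}

/-- A vector over `ℤ/4` all of whose entries are even, i.e. annihilated by `2`. -/
def EvenVec (Δ : Fin ω → ZMod 4) : Prop := ∀ j, 2 * Δ j = 0

theorem exists_dotProduct_eq_one {Δ : Fin ω → ZMod 4} (h : ¬ EvenVec Δ) :
    ∃ e : Fin ω → ZMod 4, e ⬝ᵥ Δ = 1 := by
  simp only [EvenVec, not_forall] at h
  obtain ⟨j, hj⟩ := h
  have unit : ∀ t : ZMod 4, 2 * t ≠ 0 → t * t = 1 := by decide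
  exact ⟨Pi.single j (Δ j), by rw [single_dotProduct, unit _ hj]⟩

/-- The distribution of `d ⬝ᵥ Δ` for uniform `d`. -/
noncomputable def formDist (Δ : Fin ω → ZMod 4) (τ : ZMod 4) : ℝ :=
  1 / 4 ^ ω * ∑ d : Fin ω → ZMod 4, ind (d ⬝ᵥ Δ = τ)

theorem ind_nonneg (p : Prop) : 0 ≤ ind p := by
  rw [ind]; split_ifs <;> norm_num

theorem sum_ind_eq {α : Type} [Fintype α] (a : α) : ∑ b, ind (a = b) = 1 := by
  classical
  rw [Fintype.sum_eq_single a]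
  · simp [ind]
  · intro b hb
    simp [ind, hb.symm]

theorem formDist_nonneg (Δ : Fin ω → ZMod 4) (τ : ZMod 4) : 0 ≤ formDist Δ τ :=
  mul_nonneg (by positivity) (Finset.sum_nonneg fun _ _ => ind_nonneg _)

theorem sum_formDist (Δ : Fin ω → ZMod 4) : ∑ τ, formDist Δ τ = 1 := by
  simp only [formDist]
  rw [← Finset.mul_sum, Finset.sum_comm]
  simp only [sum_ind_eq, Finset.sum_const, Finset.card_univ, nsmul_eq_mul, card_equations]
  field_simp

/-- A linear form with a unit among its coefficients is uniformly distributed. -/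
theorem formDist_eq_of_not_even {Δ : Fin ω → ZMod 4} (h : ¬ EvenVec Δ) (τ : ZMod 4) :
    formDist Δ τ = 1 / 4 := by
  obtain ⟨e, he⟩ := exists_dotProduct_eq_one h
  -- translation by a multiple of `e` identifies the fibers of the linear form
  have hshift : ∀ τ, formDist Δ τ = formDist Δ 0 := by
    intro τ
    rw [formDist, formDist, ← Equiv.sum_comp (Equiv.addRight (τ • e))]
    simp [add_dotProduct, smul_dotProduct, he]
  have hsum := sum_formDist Δ
  simp only [hshift, Finset.sum_const, Finset.card_univ, ZMod.card, nsmul_eq_mul] at hsum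
  rw [hshift]
  push_cast at hsum
  linarith

theorem distToUniform_le_one {S : Type} [Fintype S] [Nonempty S] {p : S → ℝ} (h₀ : ∀ s, 0 ≤ p s)
    (h₁ : ∑ s, p s = 1) : distToUniform p ≤ 1 := by
  have hc : (0 : ℝ) < Fintype.card S := by exact_mod_cast Fintype.card_pos
  have h : ∀ s, |p s - 1 / (Fintype.card S : ℝ)| ≤ p s + 1 / (Fintype.card S : ℝ) := by
    intro s
    have := h₀ s
    have : 0 < 1 / (Fintype.card S : ℝ) := by positivity
    rw [abs_le]
    constructor <;> linarith
  have h' := Finset.sum_le_sum fun s (_ : s ∈ Finset.univ) => h s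
  rw [Finset.sum_add_distrib, h₁, Finset.sum_const, Finset.card_univ, nsmul_eq_mul,
    mul_one_div_cancel hc.ne'] at h'
  rw [distToUniform]
  linarith

/-- The distance to uniform is convex. -/
theorem distToUniform_mixture_le {ι S : Type} [Fintype ι] [Fintype S] {w : ι → ℝ}
    (h₀ : ∀ i, 0 ≤ w i) (h₁ : ∑ i, w i = 1) (p : ι → S → ℝ) :
    distToUniform (fun s => ∑ i, w i * p i s) ≤ ∑ i, w i * distToUniform (p i) := by
  have h : ∀ s, |∑ i, w i * p i s - 1 / (Fintype.card S : ℝ)|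
      ≤ ∑ i, w i * |p i s - 1 / (Fintype.card S : ℝ)| := by
    intro s
    have e : ∑ i, w i * p i s - 1 / (Fintype.card S : ℝ)
        = ∑ i, w i * (p i s - 1 / (Fintype.card S : ℝ)) := by
      simp only [mul_sub, Finset.sum_sub_distrib, ← Finset.sum_mul, h₁, one_mul]
    rw [e]
    refine (Finset.abs_sum_le_sum_abs _ _).trans (Finset.sum_le_sum fun i _ => ?_)
    rw [abs_mul, abs_of_nonneg (h₀ i)]
  simp only [distToUniform]
  refine (mul_le_mul_of_nonneg_left (Finset.sum_le_sum fun s _ => h s) (by norm_num)).trans ?_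
  rw [Finset.sum_comm, Finset.mul_sum]
  refine le_of_eq (Finset.sum_congr rfl fun i _ => ?_)
  rw [← Finset.mul_sum]
  ring

theorem distToUniform_formDist_le (Δ : Fin ω → ZMod 4) :
    distToUniform (formDist Δ) ≤ ind (EvenVec Δ) := by
  by_cases h : EvenVec Δ
  · rw [ind, if_pos h]
    exact distToUniform_le_one (formDist_nonneg Δ) (sum_formDist Δ)
  · rw [ind, if_neg h]
    simp [distToUniform, formDist_eq_of_not_even h, ZMod.card]

/-- The sign `(-1)^W` of `t = W + 2 v`. -/
noncomputable def signW (t : ZMod 4) : ℝ := if bitW t then -1 else 1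

theorem signW_add_one (t : ZMod 4) : signW (t + 1) = -signW t := by
  have h : ∀ t, bitW (t + 1) = !bitW t := by decide
  rw [signW, signW, h]
  cases bitW t <;> simp

/-- The low bit of `d ⬝ᵥ Δ` vanishes for even `Δ` and is unbiased otherwise. -/
theorem sum_signW (Δ : Fin ω → ZMod 4) :
    ∑ d : Fin ω → ZMod 4, signW (d ⬝ᵥ Δ) = 4 ^ ω * ind (EvenVec Δ) := by
  by_cases h : EvenVec Δ
  · have h1 : ∀ d : Fin ω → ZMod 4, signW (d ⬝ᵥ Δ) = 1 := by
      intro d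
      have e : 2 * (d ⬝ᵥ Δ) = 0 := by
        rw [dotProduct, Finset.mul_sum]
        refine Finset.sum_eq_zero fun j _ => ?_
        rw [mul_left_comm, h j, mul_zero]
      have e' : ∀ t : ZMod 4, 2 * t = 0 → bitW t = false := by decide
      rw [signW, e' _ e]
      simp
    simp only [h1, Finset.sum_const, Finset.card_univ, nsmul_eq_mul, card_equations, ind, if_pos h]
  · obtain ⟨e, he⟩ := exists_dotProduct_eq_one h
    have h1 := Equiv.sum_comp (Equiv.addRight e) fun d : Fin ω → ZMod 4 => signW (d ⬝ᵥ Δ)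
    simp only [Equiv.coe_addRight, add_dotProduct, he, signW_add_one, Finset.sum_neg_distrib] at h1
    rw [ind, if_neg h, mul_zero]
    linarith

/-- A set of equations that misses few of them sees nearly the same bias of a linear form. -/
theorem sum_signW_restrict_ge (Δ : Fin ω → ZMod 4) (A B : Set (Fin ω → ZMod 4)) :
    4 ^ ω * ind (EvenVec Δ) - (Set.ncard Aᶜ + Set.ncard Bᶜ)
      ≤ ∑ d : Fin ω → ZMod 4, ind (d ∈ A ∧ d ∈ B) * signW (d ⬝ᵥ Δ) := by
  classical
  have hc : ∀ S : Set (Fin ω → ZMod 4), (Set.ncard Sᶜ : ℝ) = ∑ d, ind (d ∉ S) := by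
    intro S
    have h : ∀ d, ind (d ∉ S) = if d ∈ Sᶜ.toFinset then (1 : ℝ) else 0 := fun d => by
      by_cases hd : d ∈ S <;> simp [ind, hd]
    simp only [h]
    rw [Finset.sum_boole, Set.ncard_eq_toFinset_card', Finset.filter_univ_mem]
  rw [← sum_signW, hc, hc, ← Finset.sum_add_distrib, ← Finset.sum_sub_distrib]
  refine Finset.sum_le_sum fun d _ => ?_
  simp only [ind, signW]
  by_cases hA : d ∈ A <;> by_cases hB : d ∈ B <;> simp [hA, hB] <;> split_ifs <;> norm_num

end LinearForms

/-! ### Claws with an even difference -/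

section Claws

variable {F : TrapdoorFamilies} {ℓ : ℕ}

theorem exists_partner {kt : Bits (F.m ℓ) × Bits (F.t ℓ)} (hkt : kt ∈ (F.genF ℓ).support) :
    ∃ σ : Equiv.Perm (Dom (F.ω ℓ)), ∀ x, F.h ℓ kt.1 true (σ x) = F.h ℓ kt.1 false x := by
  have hr := F.range_F ℓ kt hkt
  have hex : ∀ x, ∃ x', F.h ℓ kt.1 true x' = F.h ℓ kt.1 false x := fun x => by
    have : F.h ℓ kt.1 false x ∈ Set.range (F.h ℓ kt.1 true) := hr ▸ ⟨x, rfl⟩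
    exact this
  choose f hf using hex
  have hinj : Function.Injective f := fun x x' h =>
    F.injective_F ℓ kt hkt false (by rw [← hf, ← hf, h])
  exact ⟨Equiv.ofBijective f (Finite.injective_iff_bijective.1 hinj), hf⟩

/-- The preimage on the branch `1` of the image of `x` on the branch `0`. -/
noncomputable def partner {kt : Bits (F.m ℓ) × Bits (F.t ℓ)} (hkt : kt ∈ (F.genF ℓ).support) :
    Equiv.Perm (Dom (F.ω ℓ)) := (exists_partner hkt).choose

theorem partner_spec {kt : Bits (F.m ℓ) × Bits (F.t ℓ)} (hkt : kt ∈ (F.genF ℓ).support)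
    (x : Dom (F.ω ℓ)) : F.h ℓ kt.1 true (partner hkt x) = F.h ℓ kt.1 false x :=
  (exists_partner hkt).choose_spec x

theorem eq_partner {kt : Bits (F.m ℓ) × Bits (F.t ℓ)} (hkt : kt ∈ (F.genF ℓ).support)
    {x₀ x₁ : Dom (F.ω ℓ)} (h : F.h ℓ kt.1 false x₀ = F.h ℓ kt.1 true x₁) : x₁ = partner hkt x₀ :=
  F.injective_F ℓ kt hkt true (by rw [partner_spec, h])

/-- The fraction of the claws `(x₀, x₁)` of `h_k` for which `x₁ - x₀` is even. -/
noncomputable def evenFraction (F : TrapdoorFamilies) (ℓ : ℕ) (k : Bits (F.m ℓ)) : ℝ :=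
  1 / 4 ^ F.ω ℓ * ∑ x₀, ind (∃ x₁, F.h ℓ k false x₀ = F.h ℓ k true x₁ ∧ EvenVec (vec x₁ - vec x₀))

theorem evenFraction_eq {kt : Bits (F.m ℓ) × Bits (F.t ℓ)} (hkt : kt ∈ (F.genF ℓ).support) :
    evenFraction F ℓ kt.1
      = 1 / 4 ^ F.ω ℓ * ∑ x, ind (EvenVec (vec (partner hkt x) - vec x)) := by
  rw [evenFraction]
  congr 1
  refine Finset.sum_congr rfl fun x _ => congrArg ind (propext ?_)
  constructor
  · rintro ⟨x₁, h, he⟩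
    rwa [eq_partner hkt h] at he
  · intro h
    exact ⟨_, (partner_spec hkt x).symm, h⟩

/-- Given the key, the angle is distributed as `d · (x₁ - x₀)` for a uniform `d` and a uniform
claw. -/
theorem distAngle_given {kt : Bits (F.m ℓ) × Bits (F.t ℓ)} (hkt : kt ∈ (F.genF ℓ).support)
    (τ : ZMod 4) :
    ∑ y, ∑ d, ind (∃ x₀ x₁, invert F ℓ false kt y = some (.two x₀ x₁) ∧ angle d x₀ x₁ = τ)
      * weight ((honest F).stateD ℓ kt.1 y d)
      = ∑ x, 1 / 4 ^ F.ω ℓ * formDist (vec (partner hkt x) - vec x) τ := by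
  have hk := evaluates_of_mem_genF hkt
  have h1 : ∀ y d, ind (∃ x₀ x₁, invert F ℓ false kt y = some (.two x₀ x₁) ∧ angle d x₀ x₁ = τ)
      * weight ((honest F).stateD ℓ kt.1 y d)
      = ∑ x, if F.h ℓ kt.1 false x = y then
        (1 / 4 ^ F.ω ℓ) ^ 2 * ind (d ⬝ᵥ (vec (partner hkt x) - vec x) = τ) else 0 := by
    intro y d
    by_cases h : ∃ x, F.h ℓ kt.1 false x = y
    · obtain ⟨x, hx⟩ := h
      have hx' : F.h ℓ kt.1 true (partner hkt x) = y := (partner_spec hkt x).trans hx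
      have hone : ∀ b x, F.h ℓ kt.1 b x = y →
          (∑ x', if F.h ℓ kt.1 b x' = y then (1 : ℝ) else 0) = 1 := by
        intro b x hx
        rw [Fintype.sum_eq_single x, if_pos hx]
        intro x' hne
        exact if_neg fun e => hne (F.injective_F ℓ kt hkt b (e.trans hx.symm))
      rw [Fintype.sum_eq_single x, if_pos hx, weight_stateD_honest hk,
        norm_branch_sq (F.injective_F ℓ kt hkt false), norm_branch_sq (F.injective_F ℓ kt hkt true),
        hone _ _ hx, hone _ _ hx']
      · have e : (∃ x₀ x₁, invert F ℓ false kt y = some (.two x₀ x₁) ∧ angle d x₀ x₁ = τ) ↔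
            d ⬝ᵥ (vec (partner hkt x) - vec x) = τ := by
          constructor
          · rintro ⟨x₀, x₁, hi, ha⟩
            obtain ⟨h₀, h₁⟩ := (invert_two hkt).1 hi
            obtain rfl : x₀ = x := F.injective_F ℓ kt hkt false (h₀.trans hx.symm)
            rw [eq_partner hkt (h₀.trans h₁.symm)] at ha
            exact ha
          · intro ha
            exact ⟨x, _, (invert_two hkt).2 ⟨hx, hx'⟩, ha⟩
        rw [e]
        ring
      · intro x' hne
        exact if_neg fun e => hne (F.injective_F ℓ kt hkt false (e.trans hx.symm))
    · push Not at h
      rw [Finset.sum_eq_zero fun x _ => if_neg (h x), ind, if_neg, zero_mul]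
      rintro ⟨x₀, x₁, hi, -⟩
      exact h x₀ ((invert_two hkt).1 hi).1
  simp only [h1]
  rw [Finset.sum_comm]
  simp only [sum_fibers (F.h ℓ kt.1 false)]
  rw [Finset.sum_comm]
  refine Finset.sum_congr rfl fun x _ => ?_
  rw [formDist, ← Finset.mul_sum]
  ring

theorem distToUniform_distAngle_le :
    distToUniform ((honest F).distAngle ℓ)
      ≤ ∑ kt, (F.genF ℓ kt).toReal * evenFraction F ℓ kt.1 := by
  refine (distToUniform_mixture_le (fun _ => ENNReal.toReal_nonneg) (sum_toReal_pmf (F.genF ℓ))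
    fun kt τ => ∑ y, ∑ d,
      ind (∃ x₀ x₁, invert F ℓ false kt y = some (.two x₀ x₁) ∧ angle d x₀ x₁ = τ)
        * weight ((honest F).stateD ℓ kt.1 y d)).trans ?_
  refine Finset.sum_le_sum fun kt _ => ?_
  by_cases hkt : kt ∈ (F.genF ℓ).support
  · refine mul_le_mul_of_nonneg_left ?_ ENNReal.toReal_nonneg
    simp only [distAngle_given hkt]
    refine (distToUniform_mixture_le (fun _ => by positivity) ?_
      fun x => formDist (vec (partner hkt x) - vec x)).trans ?_
    · rw [Finset.sum_const, Finset.card_univ, nsmul_eq_mul, card_dom]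
      field_simp
    · rw [evenFraction_eq hkt, Finset.mul_sum]
      exact Finset.sum_le_sum fun x _ =>
        mul_le_mul_of_nonneg_left (distToUniform_formDist_le _) (by positivity)
  · rw [PMF.mem_support_iff, not_not] at hkt
    simp [hkt]

end Claws

/-! ### The adversary that guesses uniformly -/

section Guess

variable {m ω r a : ℕ}

/-- Hadamard gates on all the wires that carry `(b, x, d)`. -/
def guessCircuit : Circuit m ω r a :=
  digitLoop (fun j => [.H (.xlo j), .H (.xhi j), .H (.dlo j), .H (.dhi j)]) ++ [.H .b]

theorem uniformCircuit_guessCircuit {m ω r a : ℕ → ℕ} (hω : UniformSize ω) :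
    UniformCircuit fun ℓ => (guessCircuit : Circuit (m ℓ) (ω ℓ) (r ℓ) (a ℓ)) :=
  UniformCircuit.loop_const hω _ [[.gH, .rXlo], [.gH, .rXhi], [.gH, .rDlo], [.gH, .rDhi]]
    (fun ℓ j => by simp [encodeCircuit, encodeGate, encodeWire, blockText]) _ [.gH, .rB]
    (fun ℓ => by simp [encodeCircuit, encodeGate, encodeWire])

/-- The wires that carry `(b, x, d)`. -/
def guessWires : List (Wire m ω r a) :=
  (List.finRange ω).flatMap (fun j => [.xlo j, .xhi j, .dlo j, .dhi j]) ++ [.b]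

theorem nodup_guessWires : (guessWires : List (Wire m ω r a)).Nodup := by
  rw [guessWires, List.nodup_append]
  refine ⟨?_, by simp, ?_⟩
  · rw [List.nodup_flatMap]
    refine ⟨fun j _ => by simp, (List.nodup_finRange ω).imp ?_⟩
    intro i j hij
    simp [Function.onFun, List.disjoint_left, hij]
  · rintro i hi j hj rfl
    simp_all

theorem length_guessWires : (guessWires : List (Wire m ω r a)).length = 4 * ω + 1 := by
  simp [guessWires, mul_comm]

/-- The bit assignment `|k⟩|b⟩|x⟩|0⟩|d⟩|0⟩`. -/
def guessAssignment (k : Bits m) (b : Bool) (x : Dom ω) (d : Fin ω → ZMod 4) :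
    Wire m ω r a → Bool
  | .key i => k i
  | .b => b
  | .xlo j => (x j).1
  | .xhi j => (x j).2
  | .dlo j => bitW (d j)
  | .dhi j => bitV (d j)
  | _ => false

/-- The measured tuple `(b, x, d)` is uniform. -/
theorem weight_guess (k : Bits m) (p : Bool → Dom ω → (Fin ω → ZMod 4) → Bool → Bool → Prop) :
    weight (project (fun s => p (s .b) (readX s) (readD s) (s .w) (s .v))
      (run guessCircuit (start k : State (Wire m ω r a))))
      = (1 / 2) ^ (4 * ω + 1) * ∑ b, ∑ x, ∑ d, ind (p b x d false false) := by
  classical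
  have hrun : ∀ s, run guessCircuit (start k : State (Wire m ω r a)) s
      = if ∀ i, i ∉ guessWires → s i = assignment k false (fun _ => (false, false))
        (fun _ => false) i then amplitude (4 * ω + 1) else 0 := by
    intro s
    have e : (guessCircuit : Circuit m ω r a) = guessWires.map Gate.H := by
      simp [guessCircuit, guessWires, digitLoop, List.map_flatMap]
    rw [e, start, run_hadamards _ _ nodup_guessWires, length_guessWires, amplitude]
    intro i hi
    cases i <;> first | rfl | simp [guessWires] at hi
  have hread : ∀ b x (d : Fin ω → ZMod 4),
      readD (guessAssignment k b x d : Wire m ω r a → Bool) = d :=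
    fun b x d => funext fun j => digit_bits (d j)
  let g : Bool × Dom ω × (Fin ω → ZMod 4) → Wire m ω r a → Bool :=
    fun t => guessAssignment k t.1 t.2.1 t.2.2
  have hg : Function.Injective g := by
    rintro ⟨b, x, d⟩ ⟨b', x', d'⟩ h
    have h1 : b = b' := congrFun h .b
    have h2 : x = x' := congrArg readX h
    have h3 : d = d' := by rw [← hread b x d, ← hread b' x' d']; exact congrArg readD h
    rw [h1, h2, h3]
  rw [weight, ← Fintype.sum_of_injective g hg
    (fun t => (1 / 2 : ℝ) ^ (4 * ω + 1) * ind (p t.1 t.2.1 t.2.2 false false))]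
  · simp only [← Finset.mul_sum, Fintype.sum_prod_type]
  · intro s hs
    have hn : ¬ ∀ i, i ∉ guessWires → s i = assignment k false (fun _ => (false, false))
        (fun _ => false) i := by
      intro h
      refine hs ⟨(s .b, readX s, readD s), funext fun i => ?_⟩
      cases i with
      | xlo j => rfl
      | xhi j => rfl
      | b => rfl
      | dlo j => exact (bits_digit _ _).1
      | dhi j => exact (bits_digit _ _).2
      | key i => exact (h (.key i) (by simp [guessWires])).symm
      | y i => exact (h (.y i) (by simp [guessWires])).symm
      | w => exact (h .w (by simp [guessWires])).symm
      | v => exact (h .v (by simp [guessWires])).symm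
      | anc i => exact (h (.anc i) (by simp [guessWires])).symm
    simp [project, hrun, hn]
  · rintro ⟨b, x, d⟩
    have hy : ∀ i, i ∉ guessWires → (guessAssignment k b x d : Wire m ω r a → Bool) i
        = assignment k false (fun _ => (false, false)) (fun _ => false) i := by
      intro i hi
      cases i <;> first | rfl | simp [guessWires] at hi
    have hx : readX (guessAssignment k b x d : Wire m ω r a → Bool) = x := rfl
    simp only [project, hrun, g, hread, hx, if_pos hy]
    change (1 / 2 : ℝ) ^ (4 * ω + 1) * ind (p b x d false false)
      = ‖if p b x d false false then amplitude (4 * ω + 1) else 0‖ ^ 2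
    by_cases hp : p b x d false false
    · rw [ind, if_pos hp, if_pos hp, norm_amplitude_sq, mul_one]
    · rw [ind, if_neg hp, if_neg hp, mul_zero]
      simp

end Guess

/-- The adversary that outputs uniform `b`, `x`, `d` and the bits `W = v = 0`. -/
def guesser (F : TrapdoorFamilies) : Adversary F where
  a := F.a
  circ _ := guessCircuit

theorem guesser_isQPT (F : TrapdoorFamilies) : (guesser F).IsQPT :=
  ⟨F.uniform_a, uniformCircuit_guessCircuit F.uniform_ω⟩

section Advantage

variable {F : TrapdoorFamilies} {ℓ : ℕ}
  (good : Bits (F.m ℓ) → Bool → Dom (F.ω ℓ) → Set (Fin (F.ω ℓ) → ZMod 4))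

/-- In the tuple `(b, x_b, d, W)` of a claw, `W` is right if and only if it is the low bit of
`d ⬝ᵥ (x₁ - x₀)`. -/
theorem exists_hardSet_iff {kt : Bits (F.m ℓ) × Bits (F.t ℓ)} (hkt : kt ∈ (F.genF ℓ).support)
    (b : Bool) (x : Dom (F.ω ℓ)) (d : Fin (F.ω ℓ) → ZMod 4) (W : Bool) :
    (∃ v, HardSet F ℓ good kt.1 b (if b then partner hkt x else x) d W v) ↔
      (d ∈ good kt.1 false x ∧ d ∈ good kt.1 true (partner hkt x)) ∧
        W = bitW (d ⬝ᵥ (vec (partner hkt x) - vec x)) := by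
  -- sum and difference of the members of a claw differ by an even vector
  have hW : bitW (d ⬝ᵥ (vec x + vec (partner hkt x))) = bitW (d ⬝ᵥ (vec (partner hkt x) - vec x)) := by
    have h : ∀ s t : ZMod 4, bitW (s + t) = bitW (t - s) := by decide
    rw [dotProduct_add, dotProduct_sub, h]
  constructor
  · rintro ⟨v, x₀, x₁, hclaw, hx, hg₀, hg₁, hW', -⟩
    obtain rfl := eq_partner hkt hclaw
    obtain rfl : x = x₀ := by
      cases b
      · simpa using hx
      · simpa using hx
    exact ⟨⟨hg₀, hg₁⟩, hW'.trans hW⟩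
  · rintro ⟨⟨hg₀, hg₁⟩, hW'⟩
    exact ⟨_, x, partner hkt x, (partner_spec hkt x).symm, rfl, hg₀, hg₁, hW'.trans hW.symm, rfl⟩

/-- For a fixed key, the bias of the uniform guess is the fraction of even claws, up to the fraction
of bad equations. -/
theorem guess_bias_ge {kt : Bits (F.m ℓ) × Bits (F.t ℓ)} (hkt : kt ∈ (F.genF ℓ).support) {μ : ℝ}
    (hμ : ∀ b x, (Set.ncard (good kt.1 b x)ᶜ : ℝ) / 4 ^ F.ω ℓ ≤ μ) :
    evenFraction F ℓ kt.1 - 2 * μ ≤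
      weight (project (fun s => ∃ v, HardSet F ℓ good kt.1 (s .b) (readX s) (readD s) (s .w) v)
        (run ((guesser F).circ ℓ) (start kt.1)))
      - weight (project (fun s => ∃ v, HardSet F ℓ good kt.1 (s .b) (readX s) (readD s) (!(s .w)) v)
        (run ((guesser F).circ ℓ) (start kt.1))) := by
  have h1 : ∀ W, ∑ b, ∑ x, ∑ d, ind (∃ v, HardSet F ℓ good kt.1 b x d W v)
      = 2 * ∑ x, ∑ d, ind ((d ∈ good kt.1 false x ∧ d ∈ good kt.1 true (partner hkt x)) ∧
        W = bitW (d ⬝ᵥ (vec (partner hkt x) - vec x))) := by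
    intro W
    have h2 : ∀ b, ∑ x, ∑ d, ind (∃ v, HardSet F ℓ good kt.1 b x d W v)
        = ∑ x, ∑ d, ind ((d ∈ good kt.1 false x ∧ d ∈ good kt.1 true (partner hkt x)) ∧
        W = bitW (d ⬝ᵥ (vec (partner hkt x) - vec x))) := by
      intro b
      simp only [← exists_hardSet_iff good hkt b]
      cases b
      · simp
      · simp only [if_true]
        exact (Equiv.sum_comp (partner hkt) fun x =>
          ∑ d, ind (∃ v, HardSet F ℓ good kt.1 true x d W v)).symm
    rw [Fintype.sum_bool, h2, h2, two_mul]
  have h3 := weight_guess (a := F.a ℓ) (r := F.r ℓ) kt.1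
    fun b x d W _ => ∃ v, HardSet F ℓ good kt.1 b x d W v
  have h4 := weight_guess (a := F.a ℓ) (r := F.r ℓ) kt.1
    fun b x d W _ => ∃ v, HardSet F ℓ good kt.1 b x d (!W) v
  have h5 : ∀ (p : Prop) (t : ZMod 4), ind (p ∧ false = bitW t) - ind (p ∧ true = bitW t)
      = ind p * signW t := by
    intro p t
    by_cases hp : p <;> cases h : bitW t <;> simp [ind, signW, hp, h]
  have h6 : weight (project (fun s => ∃ v, HardSet F ℓ good kt.1 (s .b) (readX s) (readD s) (s .w) v)
        (run ((guesser F).circ ℓ) (start kt.1)))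
      - weight (project (fun s => ∃ v, HardSet F ℓ good kt.1 (s .b) (readX s) (readD s) (!(s .w)) v)
        (run ((guesser F).circ ℓ) (start kt.1)))
      = (1 / 2) ^ (4 * F.ω ℓ + 1) * (2 * ∑ x, ∑ d,
        ind (d ∈ good kt.1 false x ∧ d ∈ good kt.1 true (partner hkt x)) *
          signW (d ⬝ᵥ (vec (partner hkt x) - vec x))) := by
    refine (congrArg₂ (· - ·) h3 h4).trans ?_
    simp only [Bool.not_false, h1, ← h5, Finset.sum_sub_distrib]
    ring
  have h7 : (1 / 2 : ℝ) ^ (4 * F.ω ℓ + 1) * 2 = 1 / 4 ^ F.ω ℓ * (1 / 4 ^ F.ω ℓ) := by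
    rw [pow_succ, pow_mul, ← one_div_pow, ← mul_pow]
    norm_num
    ring
  have h8 : (0 : ℝ) < 4 ^ F.ω ℓ := by positivity
  rw [h6, ← mul_assoc, h7, evenFraction_eq hkt]
  have h9 : ∀ x, 4 ^ F.ω ℓ * (ind (EvenVec (vec (partner hkt x) - vec x)) - 2 * μ)
      ≤ ∑ d, ind (d ∈ good kt.1 false x ∧ d ∈ good kt.1 true (partner hkt x)) *
          signW (d ⬝ᵥ (vec (partner hkt x) - vec x)) := by
    intro x
    refine le_trans ?_ (sum_signW_restrict_ge _ _ _)
    have e0 := (div_le_iff₀ h8).1 (hμ false x)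
    have e1 := (div_le_iff₀ h8).1 (hμ true (partner hkt x))
    linarith
  have h10 := Finset.sum_le_sum fun x (_ : x ∈ Finset.univ) => h9 x
  rw [← Finset.mul_sum, Finset.sum_sub_distrib, Finset.sum_const, Finset.card_univ, nsmul_eq_mul,
    card_dom] at h10
  have h11 := mul_le_mul_of_nonneg_left h10 (by positivity : (0 : ℝ) ≤ 1 / 4 ^ F.ω ℓ * (1 / 4 ^ F.ω ℓ))
  refine le_trans (le_of_eq ?_) h11
  field_simp

end Advantage

/-- The even claws are rare: otherwise the uniform guess would violate the hardcore bit property. -/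
theorem negligible_evenFraction {F : TrapdoorFamilies} (hF : AdaptiveHardcoreBit F) :
    ∃ μ, Negligible μ ∧ ∀ ℓ, ∑ kt, (F.genF ℓ kt).toReal * evenFraction F ℓ kt.1 ≤ μ ℓ := by
  obtain ⟨good, ⟨μ, hμ, hgood⟩, -, hadv⟩ := hF
  refine ⟨_, (hadv (guesser F) (guesser_isQPT F)).add (hμ.add hμ), fun ℓ => ?_⟩
  have h1 : ∑ kt, (F.genF ℓ kt).toReal * (evenFraction F ℓ kt.1 - 2 * μ ℓ)
      ≤ (guesser F).prob ℓ (fun k b x d W _ => ∃ v, HardSet F ℓ (good ℓ) k b x d W v)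
        - (guesser F).prob ℓ (fun k b x d W _ => ∃ v, HardSet F ℓ (good ℓ) k b x d (!W) v) := by
    rw [Adversary.prob, Adversary.prob, ← Finset.sum_sub_distrib]
    refine Finset.sum_le_sum fun kt _ => ?_
    rw [← mul_sub]
    by_cases hkt : kt ∈ (F.genF ℓ).support
    · exact mul_le_mul_of_nonneg_left (guess_bias_ge (good ℓ) hkt (hgood ℓ kt hkt))
        ENNReal.toReal_nonneg
    · rw [PMF.mem_support_iff, not_not] at hkt
      simp [hkt]
  simp only [mul_sub, Finset.sum_sub_distrib, ← Finset.sum_mul, sum_toReal_pmf, one_mul] at h1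
  have h2 := h1.trans (le_abs_self _)
  simp only [Pi.add_apply]
  linarith

end RSP

theorem mainTheorem5 (F : RSP.TrapdoorFamilies) (hF : RSP.AdaptiveHardcoreBit F) :
    ∃ P : RSP.Prover F, P.IsQPT ∧
      (∀ ℓ, P.winProb ℓ = 1) ∧
      (∀ ℓ, ∀ kt ∈ (F.genG ℓ).support, ∀ y d, P.stateD ℓ kt.1 y d ≠ 0 →
        ∃ b x, F.h ℓ kt.1 b x = y ∧
          RSP.HoldsQubit (RSP.normalize (P.stateD ℓ kt.1 y d)) (RSP.ket b)) ∧
      (∃ μ : ℕ → ℝ, RSP.Negligible μ ∧ ∀ ℓ, RSP.distToUniform (P.distB ℓ) ≤ μ ℓ) ∧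
      (∀ ℓ, ∀ kt ∈ (F.genF ℓ).support, ∀ y d, P.stateD ℓ kt.1 y d ≠ 0 →
        ∃ x₀ x₁, F.h ℓ kt.1 false x₀ = y ∧ F.h ℓ kt.1 true x₁ = y ∧
          RSP.HoldsQubit (RSP.normalize (P.stateD ℓ kt.1 y d))
            (RSP.ketPlus (Real.pi / 2 * (RSP.angle d x₀ x₁).val))) ∧
      (∃ μ : ℕ → ℝ, RSP.Negligible μ ∧ ∀ ℓ, RSP.distToUniform (P.distAngle ℓ) ≤ μ ℓ) := by
  obtain ⟨μ, hμ, hle⟩ := RSP.negligible_evenFraction hF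
  exact ⟨RSP.honest F, RSP.honest_isQPT F, RSP.winProb_honest,
    fun _ _ hkt y d => RSP.holdsQubit_ket hkt y d,
    ⟨0, Asymptotics.superpolynomialDecay_zero _ _, fun _ => RSP.distToUniform_distB.le⟩,
    fun _ _ hkt y d => RSP.holdsQubit_ketPlus hkt y d,
    ⟨μ, hμ, fun ℓ => RSP.distToUniform_distAngle_le.trans (hle ℓ)⟩⟩
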